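/- **Setting.** Consider a semi-Markov decision process (SMDP) with finite nonempty state and action spaces $\mathcal S,\mathcal A$: taking action $a$ in state $s$ leads to a next state $S$, after a holding time $\tau\ge 0$ and with a reward $R$, where $(S,\tau,R)$ has a given joint law $\mathbb P_{sa}$ on $\mathcal S\times\mathbb R_+\times\mathbb R$. Put $r_{sa}=\mathbb E_{sa}[R]$, $t_{sa}=\mathbb E_{sa}[\tau]$, $p_{ss'}^a=\mathbb P_{sa}(S=s')$. A policy $\pi$ selects the $n$th action by a measurable stochastic kernel $\pi_n(\cdot\mid h_n)$ from the history $h_n=(s_0,a_0,r_1,\tau_1,s_1,\dots,a_{n-1},r_n,\tau_n,s_n)$. With $t_0=0$, $t_n=\tau_1+\dots+\tau_n$ and $N_t=\max\{n: t_n\le t\}$, let $$r(\pi,s)=\liminf_{t\to\infty}\frac1t\,\mathbb E^\pi_s\Big[\sum_{n=1}^{N_t}R_n\Big],\qquad r^*(s)=\sup_\pi r(\pi,s).$$ Assume: 1. for some $\epsilon>0$, $\mathbb P_{sa}(\tau\le\epsilon)<1$ for all $(s,a)$, and $\mathbb E_{sa}[\tau^2]<\infty$, $\mathbb E_{sa}[R^2]<\infty$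 for all $(s,a)$; 2. the SMDP is weakly communicating: it has a unique closed communicating class (a nonempty set of states such that from each of its states every state of the set is reached with positive probability under some policy, while no state outside it is ever visited, with positive probability, under any policy), and all the other states are transient under all policies, i.e. from every initial state they are almost surely visited only finitely often. Let $d=|\mathcal S\times\mathcal A|$. For $x\in\mathbb R^d$ and $c\in\mathbb R$ let $x+c$ denote the vector obtained by adding $c$ to each component of $x$. A function $g:\mathbb R^d\to\mathbb R$ is *SISTr at $x$* if $c\mapsto g(x+c)$ is strictly increasing and maps $\mathbb R$ onto $\mathbb R$, and *SISTr* if it is so at every $x\in\mathbb R^d$. Let $f:\mathbb R^d\to\mathbb R$ be Lipschitz continuous and SISTr, and suppose that $f(cx)/c\to f_\infty(x)$ as $c\to\infty$ for every $x\in\mathbb R^d$, where $f_\infty:\mathbb R^d\to\mathbb R$ is SISTr at the origin. Let $\mathcal Q$ be the set of all $q\in\mathbb R^d$ for which there is $\bar r\in\mathbb R$ such that $$q(s,a)=r_{sa}-t_{sa}\,\bar r+\sum_{s'\in\mathcal S}p_{ss'}^a\max_{a'\in\mathcal A}q(s',a')\qquad\text{for all } s\in\mathcal S,\ a\in\mathcal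 A,$$ let $\mathcal Q_f=\{q\in\mathcal Q: f(q)=r^*(s)\text{ for all }s\in\mathcal S\}$, and let $\mathcal Q^o_{f_\infty}$ be the set of all $q\in\mathbb R^d$ such that $$q(s,a)=-t_{sa}\,f_\infty(q)+\sum_{s'\in\mathcal S}p_{ss'}^a\max_{a'\in\mathcal A}q(s',a')\qquad\text{for all } s\in\mathcal S,\ a\in\mathcal A.$$ **Proposition.** The set $\mathcal Q_f$ is nonempty, compact and connected, and $\mathcal Q^o_{f_\infty}=\{0\}$. -/

import Mathlib

open MeasureTheory ProbabilityTheory Filter Topology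
open scoped NNReal

universe u

noncomputable section

/-- A finite-space semi-Markov decision process: for each state-action pair `(s, a)`, a probability
measure on `S × ℝ≥0 × ℝ`, the joint law of the next state, the holding time and the reward. -/
structure SMDP (S A : Type u) [MeasurableSpace S] [MeasurableSpace A] where
  law : Kernel (S × A) (S × ℝ≥0 × ℝ)
  isMarkov : IsMarkovKernel law

namespace SMDP

/-- The data revealed at the `n`-th decision epoch: the initial state `s₀` for `n = 0`, and
`(a_{n-1}, (s_n, τ_n, r_n))` for `n ≥ 1`. -/
def Stage (S A : Type u) : ℕ → Type u
  | 0 => S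
  | _ + 1 => A × (S × ℝ≥0 × ℝ)

/-- The history `h_n = (s₀, a₀, r₁, τ₁, s₁, …, a_{n-1}, r_n, τ_n, s_n)`. -/
abbrev History (S A : Type u) (n : ℕ) : Type u := (i : Finset.Iic n) → Stage S A i

/-- Infinite trajectories. -/
abbrev Path (S A : Type u) : Type u := (n : ℕ) → Stage S A n

/-- The state contained in the `n`-th stage. -/
def Stage.state {S A : Type u} : (n : ℕ) → Stage S A n → S
  | 0, x => x
  | _ + 1, x => x.2.1

/-- The last state `s_n` of a history `h_n`. -/
def History.last {S A : Type u} {n : ℕ} (h : History S A n) : S :=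
  Stage.state n (h ⟨n, Finset.mem_Iic.2 le_rfl⟩)

/-- The history consisting of the initial state only. -/
def History.init {S A : Type u} (s : S) : History S A 0
  | ⟨0, _⟩ => s
  | ⟨_ + 1, h⟩ => absurd (Finset.mem_Iic.1 h) (Nat.not_succ_le_zero _)

/-- The state `S_n` along a trajectory. -/
def Path.state {S A : Type u} (ω : Path S A) (n : ℕ) : S := Stage.state n (ω n)

/-- The holding time `τ_{n+1}` of the `(n+1)`-st transition. -/
def Path.holdingTime {S A : Type u} (ω : Path S A) (n : ℕ) : ℝ :=
  (show A × (S × ℝ≥0 × ℝ) from ω (n + 1)).2.2.1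

/-- The reward `R_{n+1}` of the `(n+1)`-st transition. -/
def Path.reward {S A : Type u} (ω : Path S A) (n : ℕ) : ℝ :=
  (show A × (S × ℝ≥0 × ℝ) from ω (n + 1)).2.2.2

/-- The time `t_n = τ_1 + ⋯ + τ_n` of the `n`-th transition. -/
def Path.transitionTime {S A : Type u} (ω : Path S A) (n : ℕ) : ℝ :=
  ∑ i ∈ Finset.range n, ω.holdingTime i

/-- `N_t = max {n | t_n ≤ t}`, the number of transitions by time `t`. -/
def Path.numTransitions {S A : Type u} (ω : Path S A) (t : ℝ) : ℕ :=
  sSup {n : ℕ | ω.transitionTime n ≤ t}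

/-- `R_1 + ⋯ + R_{N_t}`, the total reward received by time `t`. -/
def Path.totalReward {S A : Type u} (ω : Path S A) (t : ℝ) : ℝ :=
  ∑ i ∈ Finset.range (ω.numTransitions t), ω.reward i

variable {S A : Type u} [MeasurableSpace S] [MeasurableSpace A]

instance Stage.instMeasurableSpace : (n : ℕ) → MeasurableSpace (Stage S A n)
  | 0 => inferInstanceAs (MeasurableSpace S)
  | _ + 1 => inferInstanceAs (MeasurableSpace (A × (S × ℝ≥0 × ℝ)))

lemma Stage.measurable_state : (n : ℕ) → Measurable (Stage.state (S := S) (A := A) n)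
  | 0 => measurable_id
  | _ + 1 => measurable_fst.comp measurable_snd

lemma History.measurable_last (n : ℕ) : Measurable (History.last (S := S) (A := A) (n := n)) :=
  (Stage.measurable_state n).comp (measurable_pi_apply _)

/-- A (randomized, history-dependent) policy: a sequence of measurable stochastic kernels selecting
the `n`-th action on the basis of the history `h_n`. -/
structure Policy (S A : Type u) [MeasurableSpace S] [MeasurableSpace A] where
  rule : (n : ℕ) → Kernel (History S A n) A
  isMarkov : ∀ n, IsMarkovKernel (rule n)

/-- The conditional law of `(a_n, (s_{n+1}, τ_{n+1}, r_{n+1}))` given `h_n`: draw `a_n` from the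
policy, then the transition from the law attached to `(s_n, a_n)`. -/
def stepKernel (M : SMDP S A) (π : Policy S A) (n : ℕ) :
    Kernel (History S A n) (Stage S A (n + 1)) :=
  show Kernel (History S A n) (A × (S × ℝ≥0 × ℝ)) from
    (π.rule n).compProd (M.law.comap (fun x : History S A n × A => (x.1.last, x.2))
      (((History.measurable_last n).comp measurable_fst).prodMk measurable_snd))

instance (M : SMDP S A) (π : Policy S A) (n : ℕ) : IsMarkovKernel (M.stepKernel π n) := by
  have := π.isMarkov n
  have := M.isMarkov
  unfold stepKernel
  exact inferInstanceAs (IsMarkovKernel ((π.rule n).compProd _))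

/-- The law of the trajectory under the policy `π` and the initial state `s`. -/
def pathLaw (M : SMDP S A) (π : Policy S A) (s : S) : Measure (Path S A) :=
  Kernel.traj (X := Stage S A) (M.stepKernel π) 0 (History.init s)

/-- The average reward rate `r(π, s) = liminf_{t → ∞} t⁻¹ E^π_s [R_1 + ⋯ + R_{N_t}]`. -/
def rewardRate (M : SMDP S A) (π : Policy S A) (s : S) : ℝ :=
  liminf (fun t : ℝ => t⁻¹ * ∫ ω, ω.totalReward t ∂(M.pathLaw π s)) atTop

/-- The optimal reward rate `r*(s)`, the supremum of `r(π, s)` over all policies. -/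
def optimalRate (M : SMDP S A) (s : S) : ℝ := ⨆ π : Policy S A, M.rewardRate π s

/-- The expected one-transition reward `r_{sa}`. -/
def meanReward (M : SMDP S A) (s : S) (a : A) : ℝ := ∫ z, z.2.2 ∂(M.law (s, a))

/-- The expected holding time `t_{sa}`. -/
def meanTime (M : SMDP S A) (s : S) (a : A) : ℝ := ∫ z, (z.2.1 : ℝ) ∂(M.law (s, a))

/-- The transition probability `p_{ss'}^a`. -/
def transProb (M : SMDP S A) (s : S) (a : A) (s' : S) : ℝ := (M.law (s, a)).real {z | z.1 = s'}

/-- Conditions on the model: holding times are not uniformly negligible, and holding times and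
rewards have finite second moments. -/
structure Regular (M : SMDP S A) : Prop where
  holding : ∃ ε : ℝ, 0 < ε ∧ ∀ s a, M.law (s, a) {z | (z.2.1 : ℝ) ≤ ε} < 1
  time_sq : ∀ s a, Integrable (fun z : S × ℝ≥0 × ℝ => (z.2.1 : ℝ) ^ 2) (M.law (s, a))
  reward_sq : ∀ s a, Integrable (fun z : S × ℝ≥0 × ℝ => z.2.2 ^ 2) (M.law (s, a))

/-- A closed communicating class: from each of its states, every state of it is reached with positive
probability under some policy, and no state outside it is ever visited under any policy. -/
structure IsClosedCommunicatingClass (M : SMDP S A) (C : Set S) : Prop where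
  nonempty : C.Nonempty
  communicating : ∀ s ∈ C, ∀ s' ∈ C, ∃ (π : Policy S A) (n : ℕ),
    0 < M.pathLaw π s {ω | ω.state n = s'}
  closed : ∀ s ∈ C, ∀ s' ∉ C, ∀ (π : Policy S A) (n : ℕ),
    M.pathLaw π s {ω | ω.state n = s'} = 0

/-- The state `s` is transient under the policy `π`: from every initial state, it is almost surely
visited only finitely often. -/
def IsTransientUnder (M : SMDP S A) (π : Policy S A) (s : S) : Prop :=
  ∀ s₀ : S, ∀ᵐ ω ∂(M.pathLaw π s₀), {n : ℕ | ω.state n = s}.Finite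

/-- A weakly communicating SMDP: it has a unique closed communicating class, and all the other
states are transient under all policies. -/
def WeaklyCommunicating (M : SMDP S A) : Prop :=
  ∃ C : Set S, M.IsClosedCommunicatingClass C ∧
    (∀ C' : Set S, M.IsClosedCommunicatingClass C' → C' = C) ∧
    ∀ s ∉ C, ∀ π : Policy S A, M.IsTransientUnder π s

variable [Fintype S] [Fintype A] [Nonempty A]

/-- `max_{a} q(s, a)`. -/
def maxVal {S A : Type u} [Fintype A] [Nonempty A] (q : S × A → ℝ) (s : S) : ℝ :=
  Finset.univ.sup' Finset.univ_nonempty fun a => q (s, a)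

/-- The set `𝒬` of all `q` such that `(r, q)` solves the average-reward optimality equation for
some real number `r`. -/
def solutionSet (M : SMDP S A) : Set (S × A → ℝ) :=
  {q | ∃ r : ℝ, ∀ s a,
    q (s, a) = M.meanReward s a - M.meanTime s a * r + ∑ s', M.transProb s a s' * maxVal q s'}

/-- The set `𝒬_f = {q ∈ 𝒬 | f(q) = r*}`, with `r*` the (constant) optimal reward rate. -/
def constrainedSolutionSet (M : SMDP S A) (f : (S × A → ℝ) → ℝ) : Set (S × A → ℝ) :=
  {q | q ∈ M.solutionSet ∧ ∀ s, f q = M.optimalRate s}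

/-- The solution set of `q(s, a) = - t_{sa} g(q) + ∑_{s'} p_{ss'}^a max_{a'} q(s', a')`. -/
def zeroRewardSolutionSet (M : SMDP S A) (g : (S × A → ℝ) → ℝ) : Set (S × A → ℝ) :=
  {q | ∀ s a, q (s, a) = -(M.meanTime s a * g q) + ∑ s', M.transProb s a s' * maxVal q s'}

end SMDP

/-- `g` is strictly increasing under scalar translation (SISTr) at `x`: the function `c ↦ g (x + c)`,
where `c` is added to each component, is strictly increasing and maps `ℝ` onto `ℝ`. -/
def SISTrAt {ι : Type u} (g : (ι → ℝ) → ℝ) (x : ι → ℝ) : Prop :=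
  StrictMono (fun c : ℝ => g (fun i => x i + c)) ∧
    Function.Surjective (fun c : ℝ => g (fun i => x i + c))

/-- `g` is SISTr: it is SISTr at every point. -/
def SISTr {ι : Type u} (g : (ι → ℝ) → ℝ) : Prop := ∀ x, SISTrAt g x

/-- Conditions on `f` and its scaling limit `f∞`. -/
structure RateEstimator {ι : Type u} [Fintype ι] (f fInf : (ι → ℝ) → ℝ) : Prop where
  lipschitz : ∃ K : ℝ≥0, LipschitzWith K f
  sistr : SISTr f
  scaling : ∀ x : ι → ℝ, Tendsto (fun c : ℝ => f (c • x) / c) atTop (𝓝 (fInf x))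
  sistr_zero : SISTrAt fInf 0

end

noncomputable section

set_option linter.unusedSectionVars false

namespace SMDP

/-! ### Elementary properties of the maximum over actions -/

section MaxVal

variable {S A : Type u} [Fintype A] [Nonempty A]

/-! Weak communication enters the dynamic programming only through one fact: a function `z` with `z
= max_a p z` is constant (`WeaklyCommunicating.harmonicConst`). Existence of a solution of the
optimality equation follows by vanishing discount: recentred and normalised discounted solutions
accumulate either at a solution or at a nonconstant such `z` (`IsTransition.exists_bellman_eq`). A
martingale-type argument with Wald's identity shows that any rate occurring in a solution is the
optimal reward rate (`Regular.optimalRate_eq`), so all of `𝒬` solves a single equation with one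
fixed rate.

For that rate, the fixed points of the dynamic programming operator are connected: the maximum of
one fixed point and a translate of another is a subsolution, iteration carries it up to a fixed
point, and varying the translation traces a curve between the two, up to a final translation
(`IsTransition.isPreconnected_fixedPoints`). Solutions are stable under adding constants, and SISTr
provides a continuous choice of the constant that brings `f` to the level `r*`; hence `𝒬_f` is a
continuous image of a connected set.

Boundedness is a blow-up argument: normalised unbounded solutions converge to a solution of the
equation without rewards, which is a constant of norm one at which `f∞` vanishes, contradicting
SISTr at the origin (`isBounded_level_qSolutions`). For `𝒬ᵒ`, comparison at the extrema of `max_a q`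
forces `f∞(q) = 0`, and then constancy and SISTr at the origin give `q = 0`. -/

lemma le_maxVal (q : S × A → ℝ) (s : S) (a : A) : q (s, a) ≤ maxVal q s :=
  Finset.le_sup' (fun a => q (s, a)) (Finset.mem_univ a)

lemma maxVal_le {q : S × A → ℝ} {s : S} {c : ℝ} (h : ∀ a, q (s, a) ≤ c) : maxVal q s ≤ c :=
  Finset.sup'_le _ _ fun a _ => h a

lemma exists_maxVal_eq (q : S × A → ℝ) (s : S) : ∃ a, maxVal q s = q (s, a) := by
  obtain ⟨a, -, ha⟩ := Finset.exists_mem_eq_sup' Finset.univ_nonempty (fun a => q (s, a))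
  exact ⟨a, ha⟩

lemma maxVal_mono {q q' : S × A → ℝ} (h : q ≤ q') (s : S) : maxVal q s ≤ maxVal q' s :=
  maxVal_le fun a => (h (s, a)).trans (le_maxVal q' s a)

lemma maxVal_add_const (q : S × A → ℝ) (c : ℝ) (s : S) :
    maxVal (fun x => q x + c) s = maxVal q s + c := by
  apply le_antisymm
  · exact maxVal_le fun a => by simpa using le_maxVal q s a
  · obtain ⟨a, ha⟩ := exists_maxVal_eq q s
    rw [ha]
    exact le_maxVal (fun x => q x + c) s a

lemma maxVal_const_mul (q : S × A → ℝ) {c : ℝ} (hc : 0 ≤ c) (s : S) :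
    maxVal (fun x => c * q x) s = c * maxVal q s := by
  apply le_antisymm
  · exact maxVal_le fun a => mul_le_mul_of_nonneg_left (le_maxVal q s a) hc
  · obtain ⟨a, ha⟩ := exists_maxVal_eq q s
    rw [ha]
    exact le_maxVal (fun x => c * q x) s a

lemma abs_maxVal_sub_le {q q' : S × A → ℝ} {s : S} {c : ℝ}
    (h : ∀ a, |q (s, a) - q' (s, a)| ≤ c) : |maxVal q s - maxVal q' s| ≤ c := by
  rw [abs_sub_le_iff, sub_le_iff_le_add, sub_le_iff_le_add]
  refine ⟨maxVal_le fun a => ?_, maxVal_le fun a => ?_⟩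
  · linarith [le_maxVal q' s a, (abs_le.1 (h a)).2]
  · linarith [le_maxVal q s a, (abs_le.1 (h a)).1]

@[fun_prop]
lemma continuous_maxVal : Continuous (maxVal : (S × A → ℝ) → S → ℝ) := by
  refine continuous_pi fun s => ?_
  exact Continuous.finset_sup'_apply Finset.univ_nonempty fun a _ => continuous_apply (s, a)

end MaxVal

/-! ### The dynamic programming operator and connectedness of its fixed points -/

section Bellman

variable {S A : Type u} [Fintype S] [Fintype A] [Nonempty A]

/-- The state-action values obtained from one-step rewards `r`, weights `p` and state values `v`. -/
def lookahead (p : S → A → S → ℝ) (r : S → A → ℝ) (v : S → ℝ) : S × A → ℝ :=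
  fun x => r x.1 x.2 + ∑ s', p x.1 x.2 s' * v s'

/-- The dynamic programming operator `v ↦ max_a (r + p v)`. -/
def bellman (p : S → A → S → ℝ) (r : S → A → ℝ) (v : S → ℝ) : S → ℝ :=
  maxVal (lookahead p r v)

/-- `p` is a family of probability vectors. -/
structure IsTransition (p : S → A → S → ℝ) : Prop where
  nonneg : ∀ s a s', 0 ≤ p s a s'
  sum_eq_one : ∀ s a, ∑ s', p s a s' = 1

/-- Every solution of `z = max_a p z` is constant. -/
def HarmonicConst (p : S → A → S → ℝ) : Prop :=
  ∀ z : S → ℝ, bellman p 0 z = z → ∀ s s', z s = z s'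

variable {p : S → A → S → ℝ} {r t : S → A → ℝ}

@[fun_prop]
lemma continuous_lookahead : Continuous (lookahead p r) := by
  unfold lookahead; fun_prop

@[fun_prop]
lemma continuous_bellman : Continuous (bellman p r) :=
  continuous_maxVal.comp continuous_lookahead

lemma IsTransition.lookahead_add_const (hp : IsTransition p) (v : S → ℝ) (c : ℝ) :
    lookahead p r (fun s => v s + c) = fun x => lookahead p r v x + c := by
  funext x
  simp only [lookahead, mul_add, Finset.sum_add_distrib, ← Finset.sum_mul, hp.sum_eq_one]
  ring

lemma IsTransition.bellman_add_const (hp : IsTransition p) (v : S → ℝ) (c : ℝ) :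
    bellman p r (fun s => v s + c) = fun s => bellman p r v s + c := by
  funext s
  simp only [bellman, hp.lookahead_add_const, maxVal_add_const]

lemma IsTransition.bellman_mono (hp : IsTransition p) : Monotone (bellman p r) := by
  intro v w h s
  refine maxVal_mono (fun x => ?_) s
  have := Finset.sum_le_sum fun s' (_ : s' ∈ Finset.univ) =>
    mul_le_mul_of_nonneg_left (h s') (hp.nonneg x.1 x.2 s')
  simpa [lookahead] using this

/-- Serves both as nonexpansiveness (`γ = 1`, stochastic weights) and as contraction (`γ < 1`,
discounted weights). -/
lemma abs_bellman_sub_le (hp : ∀ s a s', 0 ≤ p s a s') {γ : ℝ} (hγ : ∀ s a, ∑ s', p s a s' ≤ γ)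
    {v w : S → ℝ} {c : ℝ} (hc : 0 ≤ c) (h : ∀ s, |v s - w s| ≤ c) (s : S) :
    |bellman p r v s - bellman p r w s| ≤ γ * c := by
  refine abs_maxVal_sub_le fun a => ?_
  have e : lookahead p r v (s, a) - lookahead p r w (s, a) = ∑ s', p s a s' * (v s' - w s') := by
    simp only [lookahead, mul_sub, Finset.sum_sub_distrib]; ring
  rw [e]
  calc |∑ s', p s a s' * (v s' - w s')| ≤ ∑ s', |p s a s' * (v s' - w s')| :=
        Finset.abs_sum_le_sum_abs _ _
    _ ≤ ∑ s', p s a s' * c := by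
        refine Finset.sum_le_sum fun s' _ => ?_
        rw [abs_mul, abs_of_nonneg (hp s a s')]
        exact mul_le_mul_of_nonneg_left (h s') (hp s a s')
    _ = (∑ s', p s a s') * c := by rw [Finset.sum_mul]
    _ ≤ γ * c := mul_le_mul_of_nonneg_right (hγ s a) hc

lemma exists_bellman_fixedPoint (hp : ∀ s a s', 0 ≤ p s a s') {γ : ℝ≥0} (hγ1 : γ < 1)
    (hγ : ∀ s a, ∑ s', p s a s' ≤ γ) : ∃ v, bellman p r v = v := by
  have hc : ContractingWith γ (bellman p r) := by
    refine ⟨hγ1, LipschitzWith.of_dist_le_mul fun v w => ?_⟩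
    rw [dist_pi_le_iff (by positivity)]
    intro s
    exact abs_bellman_sub_le hp hγ dist_nonneg (fun s' => dist_le_pi_dist v w s') s
  exact ⟨hc.fixedPoint, hc.fixedPoint_isFixedPt⟩

/-- The fixed points of the dynamic programming operator form a connected set. -/
lemma IsTransition.isPreconnected_fixedPoints (hp : IsTransition p) :
    IsPreconnected {v | bellman p r v = v} := by
  set T := bellman p r with hT
  have hmono : Monotone T := hp.bellman_mono
  have hadd : ∀ v c, T v = v → T (fun s => v s + c) = fun s => v s + c := fun v c hv => by
    rw [hT, hp.bellman_add_const, ← hT, hv]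
  have hne : ∀ (v w : S → ℝ) (c : ℝ), 0 ≤ c → (∀ s, |v s - w s| ≤ c) →
      ∀ n s, |T^[n] v s - T^[n] w s| ≤ c := by
    intro v w c hc h n
    induction n with
    | zero => exact h
    | succ n ih =>
      intro s
      rw [Function.iterate_succ_apply', Function.iterate_succ_apply']
      simpa using abs_bellman_sub_le (r := r) hp.nonneg (fun s a => (hp.sum_eq_one s a).le) hc ih s
  refine isPreconnected_of_forall_pair fun u hu v hv => ?_
  -- A maximum of two fixed points is in general only a subsolution, but monotone iteration repairs
  -- this. The correction is nonexpansive, hence continuous in `θ`.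
  set x : ℝ → S → ℝ := fun θ s => max (u s) (v s + θ) with hx
  obtain ⟨b, hb⟩ : ∃ b : ℝ, ∀ s, |u s - v s| ≤ b :=
    ⟨‖u - v‖, fun s => by simpa using norm_le_pi_norm (u - v) s⟩
  have hxT : ∀ θ, x θ ≤ T (x θ) := by
    intro θ s
    refine max_le ?_ ?_
    · have := hmono (show u ≤ x θ from fun s => le_max_left _ _) s
      rwa [hu] at this
    · have := hmono (show (fun s => v s + θ) ≤ x θ from fun s => le_max_right _ _) s
      rwa [hadd v θ hv] at this
  have hiter : ∀ θ, Monotone fun n => T^[n] (x θ) := fun θ =>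
    hmono.monotone_iterate_of_le_map (hxT θ)
  have hbdd : ∀ θ n s, T^[n] (x θ) s ≤ u s + (b + |θ|) := by
    intro θ n s
    have hb0 : 0 ≤ b := (abs_nonneg _).trans (hb s)
    have h1 : x θ ≤ fun s => u s + (b + |θ|) := by
      intro s
      have := abs_le.1 (hb s)
      have := le_abs_self θ
      have := abs_nonneg θ
      exact max_le (by linarith) (by linarith)
    have h2 := (hmono.iterate n) h1 s
    have h3 : T^[n] (fun s => u s + (b + |θ|)) = fun s => u s + (b + |θ|) :=
      Function.iterate_fixed (hadd u _ hu) n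
    rwa [h3] at h2
  set R : ℝ → S → ℝ := fun θ s => ⨆ n, T^[n] (x θ) s with hR
  have hlim : ∀ θ, Tendsto (fun n => T^[n] (x θ)) atTop (𝓝 (R θ)) := by
    intro θ
    rw [tendsto_pi_nhds]
    intro s
    exact tendsto_atTop_ciSup (fun m n h => hiter θ h s) ⟨_, by
      rintro _ ⟨n, rfl⟩; exact hbdd θ n s⟩
  have hRfix : ∀ θ, T (R θ) = R θ := by
    intro θ
    have h1 := (continuous_bellman (p := p) (r := r)).continuousAt.tendsto.comp (hlim θ)
    have h2 := (tendsto_add_atTop_iff_nat 1).2 (hlim θ)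
    refine tendsto_nhds_unique h1 (h2.congr fun n => ?_)
    rw [Function.iterate_succ_apply']; rfl
  have hRfix' : ∀ θ, T (x θ) = x θ → R θ = x θ := by
    intro θ h
    refine tendsto_nhds_unique (hlim θ) ?_
    simp only [Function.iterate_fixed h]
    exact tendsto_const_nhds
  have hRcont : Continuous R := by
    refine LipschitzWith.continuous (K := 1) (LipschitzWith.of_dist_le_mul fun θ θ' => ?_)
    rw [dist_pi_le_iff (by positivity)]
    intro s
    have h1 := ((tendsto_pi_nhds.1 (hlim θ) s).sub (tendsto_pi_nhds.1 (hlim θ') s)).abs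
    refine le_of_tendsto h1 (Eventually.of_forall fun n => ?_)
    rw [NNReal.coe_one, one_mul, Real.dist_eq]
    refine hne _ _ _ (abs_nonneg _) (fun s => ?_) n s
    refine (abs_max_sub_max_le_max _ _ _ _).trans ?_
    simp
  -- Beyond the distance `b` one of the two functions dominates everywhere, so the maximum is
  -- already a fixed point.
  have hRu : R (-b) = u := by
    have : x (-b) = u := by
      funext s
      have := abs_le.1 (hb s)
      exact max_eq_left (by linarith)
    rw [hRfix' _ (by rw [this]; exact hu), this]
  have hRv : R b = fun s => v s + b := by
    have : x b = fun s => v s + b := by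
      funext s
      have := abs_le.1 (hb s)
      exact max_eq_right (by linarith)
    rw [hRfix' _ (by rw [this]; exact hadd v b hv), this]
  -- The curve `R` ends at `v + b` rather than at `v`; the line of translates of `v` closes the gap.
  have hc2 : Continuous fun (c : ℝ) (s : S) => v s + c := by fun_prop
  refine ⟨Set.range R ∪ Set.range (fun (c : ℝ) (s : S) => v s + c), ?_, Or.inl ⟨_, hRu⟩,
    Or.inr ⟨0, by simp⟩, ?_⟩
  · rintro w (⟨θ, rfl⟩ | ⟨c, rfl⟩)
    · exact hRfix θ
    · exact hadd v c hv
  · exact (isPreconnected_range hRcont).union (fun s => v s + b) ⟨b, hRv⟩ ⟨b, rfl⟩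
      (isPreconnected_range hc2)

end Bellman

/-! ### Solving the optimality equation by vanishing discount -/

section Existence

variable {S A : Type u} [Fintype S] [Fintype A] [Nonempty A]
variable {p : S → A → S → ℝ} {r t : S → A → ℝ}

/-- Positive homogeneity, jointly in rewards and values; it is what makes the normalisation of
discounted solutions, and its undoing in the limit, possible. -/
lemma bellman_const_mul (v : S → ℝ) {c : ℝ} (hc : 0 ≤ c) :
    bellman p (fun s a => c * r s a) (fun s => c * v s) = fun s => c * bellman p r v s := by
  funext s
  rw [bellman, bellman, ← maxVal_const_mul _ hc]
  congr 1
  funext x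
  simp only [lookahead, mul_add, Finset.mul_sum]
  congr 1
  exact Finset.sum_congr rfl fun _ _ => by ring

/-- A discounted fixed point, recentred at `s₀`, solves a perturbed average-reward equation whose
rate is controlled by the one-step rewards. -/
lemma IsTransition.exists_discounted (hp : IsTransition p) {C δ l : ℝ} (hδ : 0 < δ)
    (ht : ∀ s a, δ ≤ t s a) (hr : ∀ s a, |r s a| ≤ C) (hl : 0 < l) (hlt : ∀ s a, l * t s a ≤ 1 / 2)
    (s₀ : S) :
    ∃ (h : S → ℝ) (ρ : ℝ), h s₀ = 0 ∧ |ρ| ≤ C / δ ∧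
      bellman (fun s a s' => (1 - l * t s a) * p s a s') (fun s a => r s a - t s a * ρ) h = h := by
  set p' : S → A → S → ℝ := fun s a s' => (1 - l * t s a) * p s a s' with hp'
  have hp0 : ∀ s a s', 0 ≤ p' s a s' := fun s a s' =>
    mul_nonneg (by linarith [hlt s a]) (hp.nonneg s a s')
  have hsum : ∀ s a, ∑ s', p' s a s' = 1 - l * t s a := fun s a => by
    simp only [hp', ← Finset.mul_sum, hp.sum_eq_one, mul_one]
  have hlδ : 0 ≤ 1 - l * δ := by
    obtain ⟨a⟩ := ‹Nonempty A›
    have := mul_le_mul_of_nonneg_left (ht s₀ a) hl.le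
    linarith [hlt s₀ a]
  have hsumle : ∀ s a, ∑ s', p' s a s' ≤ 1 - l * δ := fun s a => by
    rw [hsum]
    linarith [mul_le_mul_of_nonneg_left (ht s a) hl.le]
  obtain ⟨v, hv⟩ : ∃ v, bellman p' r v = v :=
    exists_bellman_fixedPoint hp0 (γ := (1 - l * δ).toNNReal)
      (by rw [Real.toNNReal_lt_one]; linarith [mul_pos hl hδ])
      (by rwa [Real.coe_toNNReal _ hlδ])
  have hC : 0 ≤ C := by
    obtain ⟨a⟩ := ‹Nonempty A›
    exact (abs_nonneg _).trans (hr s₀ a)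
  have hvb : l * ‖v‖ ≤ C / δ := by
    have h0 : ∀ s, |v s| ≤ C + (1 - l * δ) * ‖v‖ := by
      intro s
      have h1 := abs_bellman_sub_le (r := r) hp0 hsumle (v := v) (w := 0) (norm_nonneg v)
        (fun s => by simpa using norm_le_pi_norm v s) s
      have h2 : |bellman p' r 0 s| ≤ C := by
        obtain ⟨a, ha⟩ := exists_maxVal_eq (lookahead p' r 0) s
        rw [bellman, ha]
        simpa [lookahead] using hr s a
      rw [hv] at h1
      have h3 := abs_sub_abs_le_abs_sub (v s) (bellman p' r 0 s)
      linarith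
    have h4 : ‖v‖ ≤ C + (1 - l * δ) * ‖v‖ :=
      (pi_norm_le_iff_of_nonneg (add_nonneg hC (mul_nonneg hlδ (norm_nonneg _)))).2 h0
    rw [le_div_iff₀ hδ]
    linarith
  -- The weights sum to `1 - l t`, so subtracting the constant `v s₀` leaves a remainder `l t v s₀`,
  -- which is exactly what the rate `l v s₀` absorbs.
  refine ⟨fun s => v s - v s₀, l * v s₀, sub_self _, ?_, ?_⟩
  · rw [abs_mul, abs_of_pos hl]
    exact (mul_le_mul_of_nonneg_left (by simpa using norm_le_pi_norm v s₀) hl.le).trans hvb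
  · have e : lookahead p' (fun s a => r s a - t s a * (l * v s₀)) (fun s => v s - v s₀) =
        fun x => lookahead p' r v x + -v s₀ := by
      funext x
      simp only [lookahead, mul_sub, Finset.sum_sub_distrib, ← Finset.sum_mul, hsum]
      ring
    funext s
    rw [bellman, e, maxVal_add_const, ← bellman, hv]
    ring

/-- Existence of a solution of the average-reward optimality equation. -/
theorem IsTransition.exists_bellman_eq [Nonempty S] (hp : IsTransition p) (hH : HarmonicConst p)
    (ht : ∀ s a, 0 < t s a) :
    ∃ (ρ : ℝ) (v : S → ℝ), bellman p (fun s a => r s a - t s a * ρ) v = v := by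
  obtain ⟨s₀⟩ := ‹Nonempty S›
  have : Nonempty S := ⟨s₀⟩
  obtain ⟨x₁, hx₁⟩ := Finite.exists_min fun x : S × A => t x.1 x.2
  obtain ⟨x₂, hx₂⟩ := Finite.exists_max fun x : S × A => t x.1 x.2
  obtain ⟨x₃, hx₃⟩ := Finite.exists_max fun x : S × A => |r x.1 x.2|
  set δ := t x₁.1 x₁.2
  set B := t x₂.1 x₂.2
  set C := |r x₃.1 x₃.2|
  have hδ : 0 < δ := ht _ _
  have hB : 0 < B := ht _ _
  -- The factor `1 / (2B)` ensures `l t ≤ 1/2`, which keeps the discounted weights nonnegative.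
  set l : ℕ → ℝ := fun k => 1 / ((k : ℝ) + 1) * (1 / (2 * B)) with hl
  have hlpos : ∀ k, 0 < l k := fun k => by positivity
  have hl0 : Tendsto l atTop (𝓝 0) := by
    simpa only [zero_mul] using
      (tendsto_one_div_add_atTop_nhds_zero_nat (𝕜 := ℝ)).mul_const (1 / (2 * B))
  have hlt : ∀ k s a, l k * t s a ≤ 1 / 2 := by
    intro k s a
    have h1 : l k ≤ 1 / (2 * B) := by
      refine mul_le_of_le_one_left (by positivity) ?_
      rw [div_le_one (by positivity)]
      linarith [(Nat.cast_nonneg k : (0 : ℝ) ≤ k)]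
    calc l k * t s a ≤ 1 / (2 * B) * B :=
          mul_le_mul h1 (hx₂ (s, a)) (ht s a).le (by positivity)
      _ = 1 / 2 := by field_simp
  choose h ρ hh0 hρ hfix using fun k => hp.exists_discounted hδ (fun s a => hx₁ (s, a))
    (fun s a => hx₃ (s, a)) (hlpos k) (hlt k) s₀
  -- No bound on `h k` is known. With this scaling `‖y k‖ + θ k = 1`, so a subsequence converges and
  -- the limit cannot be trivial in both components.
  set θ : ℕ → ℝ := fun k => (1 + ‖h k‖)⁻¹ with hθ
  have hθpos : ∀ k, 0 < θ k := fun k => by positivity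
  set y : ℕ → S → ℝ := fun k s => θ k * h k s with hy
  have hynorm : ∀ k, ‖y k‖ + θ k = 1 := by
    intro k
    have : y k = θ k • h k := by funext s; simp [hy]
    rw [this, norm_smul, Real.norm_of_nonneg (hθpos k).le]
    have : 1 + ‖h k‖ ≠ 0 := by positivity
    simp only [hθ]
    field_simp
    ring
  have hyfix : ∀ k, bellman (fun s a s' => (1 - l k * t s a) * p s a s')
      (fun s a => θ k * (r s a - t s a * ρ k)) (y k) = y k := by
    intro k
    have := bellman_const_mul (p := fun s a s' => (1 - l k * t s a) * p s a s')
      (r := fun s a => r s a - t s a * ρ k) (h k) (hθpos k).le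
    rw [hfix k] at this
    exact this
  obtain ⟨⟨y', θ', ρ'⟩, -, φ, hφ, hlim⟩ := tendsto_subseq_of_bounded
    (x := fun k => (y k, θ k, ρ k)) (s := Metric.closedBall 0 (max 1 (C / δ)))
    Metric.isBounded_closedBall (by
      intro k
      have h1 := hynorm k
      have h2 := hθpos k
      have h3 := norm_nonneg (y k)
      rw [mem_closedBall_zero_iff, Prod.norm_def, Prod.norm_def]
      refine max_le (le_max_of_le_left (by simp only; linarith))
        (max_le (le_max_of_le_left ?_) (le_max_of_le_right ?_))
      · rw [Real.norm_of_nonneg (by exact h2.le)]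
        simp only; linarith
      · exact hρ k)
  have hy' : Tendsto (fun k => y (φ k)) atTop (𝓝 y') :=
    (continuous_fst.tendsto _).comp hlim
  have hθ' : Tendsto (fun k => θ (φ k)) atTop (𝓝 θ') :=
    (continuous_fst.tendsto _).comp ((continuous_snd.tendsto _).comp hlim)
  have hρ' : Tendsto (fun k => ρ (φ k)) atTop (𝓝 ρ') :=
    (continuous_snd.tendsto _).comp ((continuous_snd.tendsto _).comp hlim)
  have hl' : Tendsto (fun k => l (φ k)) atTop (𝓝 0) := hl0.comp hφ.tendsto_atTop
  have hlimfix : bellman p (fun s a => θ' * (r s a - t s a * ρ')) y' = y' := by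
    have h1 : Tendsto (fun k => bellman (fun s a s' => (1 - l (φ k) * t s a) * p s a s')
        (fun s a => θ (φ k) * (r s a - t s a * ρ (φ k))) (y (φ k))) atTop
        (𝓝 (bellman p (fun s a => θ' * (r s a - t s a * ρ')) y')) := by
      refine (continuous_maxVal.tendsto _).comp (tendsto_pi_nhds.2 fun x => ?_)
      simp only [lookahead]
      refine (hθ'.mul (tendsto_const_nhds.sub (tendsto_const_nhds.mul hρ'))).add
        (tendsto_finsetSum _ fun s' _ => ?_)
      have h2 : Tendsto (fun k => (1 - l (φ k) * t x.1 x.2) * p x.1 x.2 s') atTop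
          (𝓝 (p x.1 x.2 s')) := by
        simpa using ((tendsto_const_nhds (x := (1 : ℝ))).sub
          (hl'.mul_const (t x.1 x.2))).mul_const (p x.1 x.2 s')
      exact h2.mul (tendsto_pi_nhds.1 hy' s')
    exact tendsto_nhds_unique h1 (hy'.congr fun k => (hyfix (φ k)).symm)
  have hnorm' : ‖y'‖ + θ' = 1 :=
    tendsto_nhds_unique (hy'.norm.add hθ') (by simp only [hynorm]; exact tendsto_const_nhds)
  have hy0 : y' s₀ = 0 :=
    tendsto_nhds_unique (tendsto_pi_nhds.1 hy' s₀) (by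
      simp only [hy, hh0, mul_zero]; exact tendsto_const_nhds)
  have hθ'0 : 0 ≤ θ' := ge_of_tendsto' hθ' fun k => (hθpos _).le
  -- If `θ' = 0` the rewards disappear in the limit, so `y'` is constant, vanishes at `s₀`, and yet
  -- has norm one. Otherwise dividing by `θ'` gives the solution.
  rcases hθ'0.eq_or_lt with h0 | hpos
  · exfalso
    subst h0
    simp only [zero_mul] at hlimfix
    have hc := hH y' hlimfix
    have : y' = 0 := by funext s; rw [hc s s₀, hy0]; rfl
    rw [this] at hnorm'
    simp at hnorm'
  · refine ⟨ρ', fun s => θ'⁻¹ * y' s, ?_⟩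
    have := bellman_const_mul (p := p) (r := fun s a => θ' * (r s a - t s a * ρ')) y'
      (inv_pos.2 hpos).le
    rw [hlimfix] at this
    simpa only [inv_mul_cancel_left₀ hpos.ne'] using this

end Existence

/-! ### Disintegration of the trajectory law along one transition -/

section PathLaw

/-- The action `a_n` along a trajectory. -/
def Path.action {S A : Type u} (ω : Path S A) (n : ℕ) : A :=
  (show A × (S × ℝ≥0 × ℝ) from ω (n + 1)).1

/-- The outcome `(s_{n+1}, τ_{n+1}, r_{n+1})` of the `(n+1)`-st transition. -/
def Path.outcome {S A : Type u} (ω : Path S A) (n : ℕ) : S × ℝ≥0 × ℝ :=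
  (show A × (S × ℝ≥0 × ℝ) from ω (n + 1)).2

/-- The history `h_n` along a trajectory. -/
def Path.history {S A : Type u} (ω : Path S A) (n : ℕ) : History S A n :=
  Preorder.frestrictLe n ω


variable {S A : Type u} [MeasurableSpace S] [MeasurableSpace A]

lemma Path.measurable_stage (n : ℕ) :
    Measurable (fun ω : Path S A => (show A × (S × ℝ≥0 × ℝ) from ω (n + 1))) :=
  measurable_pi_apply (X := Stage S A) (n + 1)

lemma Path.measurable_action (n : ℕ) : Measurable (fun ω : Path S A => ω.action n) :=
  measurable_fst.comp (Path.measurable_stage n)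

lemma Path.measurable_outcome (n : ℕ) : Measurable (fun ω : Path S A => ω.outcome n) :=
  measurable_snd.comp (Path.measurable_stage n)

lemma Path.measurable_state (n : ℕ) : Measurable (fun ω : Path S A => ω.state n) :=
  (Stage.measurable_state n).comp (measurable_pi_apply n)

lemma Path.measurable_history (n : ℕ) : Measurable (fun ω : Path S A => ω.history n) :=
  Preorder.measurable_frestrictLe n

variable (M : SMDP S A) (π : Policy S A)

instance : IsMarkovKernel M.law := M.isMarkov

instance (n : ℕ) : IsMarkovKernel (π.rule n) := π.isMarkov n

instance (s : S) : IsProbabilityMeasure (M.pathLaw π s) := by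
  unfold pathLaw; infer_instance

/-- The law of the outcome given the history and the action. -/
def outcomeKernel (n : ℕ) : Kernel (History S A n × A) (S × ℝ≥0 × ℝ) :=
  M.law.comap (fun x : History S A n × A => (x.1.last, x.2))
    (((History.measurable_last n).comp measurable_fst).prodMk measurable_snd)

instance (n : ℕ) : IsMarkovKernel (M.outcomeKernel n) := by
  unfold outcomeKernel; infer_instance

lemma outcomeKernel_apply {n : ℕ} (x : History S A n × A) :
    M.outcomeKernel n x = M.law (x.1.last, x.2) := rfl

/-- The Ionescu-Tulcea construction read at one step, with the next stage split into action and
outcome. -/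
lemma map_history_stage (s : S) (n : ℕ) :
    (M.pathLaw π s).map (fun ω => (ω.history n, (ω.action n, ω.outcome n))) =
      ((M.pathLaw π s).map fun ω => ω.history n) ⊗ₘ ((π.rule n) ⊗ₖ M.outcomeKernel n) := by
  have h := Kernel.partialTraj_compProd_eq_map_traj (κ := M.stepKernel π) (Nat.zero_le n)
    (x₀ := History.init s)
  rw [← Kernel.traj_map_frestrictLe_apply] at h
  exact h.symm

lemma map_history_action (s : S) (n : ℕ) :
    (M.pathLaw π s).map (fun ω => (ω.history n, ω.action n)) =
      ((M.pathLaw π s).map fun ω => ω.history n) ⊗ₘ (π.rule n) := by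
  have h := congrArg (Measure.map (Prod.map id Prod.fst)) (M.map_history_stage π s n)
  rw [Measure.map_map (by fun_prop) ((Path.measurable_history n).prodMk
    ((Path.measurable_action n).prodMk (Path.measurable_outcome n))),
    ← Measure.compProd_map measurable_fst, ← Kernel.fst_eq, Kernel.fst_compProd] at h
  exact h

lemma map_history_action_outcome (s : S) (n : ℕ) :
    (M.pathLaw π s).map (fun ω => ((ω.history n, ω.action n), ω.outcome n)) =
      ((M.pathLaw π s).map fun ω => (ω.history n, ω.action n)) ⊗ₘ M.outcomeKernel n := by
  have h := congrArg (Measure.map MeasurableEquiv.prodAssoc.symm) (M.map_history_stage π s n)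
  rw [Measure.map_map (by fun_prop) ((Path.measurable_history n).prodMk
    ((Path.measurable_action n).prodMk (Path.measurable_outcome n)))] at h
  rw [map_history_action, ← Measure.compProd_assoc]
  exact h

variable [Finite S] [Finite A] [MeasurableSingletonClass S] [MeasurableSingletonClass A]

section OneStep

variable {M} {n : ℕ} {D : Set (History S A n)} {g : (S × A) × (S × ℝ≥0 × ℝ) → ℝ}

/-- The conditional first absolute moments of `g` are bounded uniformly because there are only
finitely many state-action pairs. -/
lemma integrable_compProd_indicator (s : S) (hD : MeasurableSet D) (hg : Measurable g)
    (hint : ∀ x, Integrable (fun z => g (x, z)) (M.law x)) :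
    Integrable (fun y : (History S A n × A) × (S × ℝ≥0 × ℝ) =>
        D.indicator (fun _ => (1 : ℝ)) y.1.1 * g ((y.1.1.last, y.1.2), y.2))
      (((M.pathLaw π s).map fun ω => (ω.history n, ω.action n)) ⊗ₘ M.outcomeKernel n) := by
  have : IsProbabilityMeasure ((M.pathLaw π s).map fun ω => (ω.history n, ω.action n)) :=
    Measure.isProbabilityMeasure_map
      ((Path.measurable_history n).prodMk (Path.measurable_action n)).aemeasurable
  have hI : Measurable (D.indicator (fun _ => (1 : ℝ))) := measurable_const.indicator hD
  have hl : Measurable fun x : History S A n × A => (x.1.last, x.2) :=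
    ((History.measurable_last n).comp measurable_fst).prodMk measurable_snd
  have hm : Measurable (fun y : (History S A n × A) × (S × ℝ≥0 × ℝ) =>
      D.indicator (fun _ => (1 : ℝ)) y.1.1 * g ((y.1.1.last, y.1.2), y.2)) :=
    (hI.comp (measurable_fst.comp measurable_fst)).mul
      (hg.comp ((hl.comp measurable_fst).prodMk measurable_snd))
  rw [Measure.integrable_compProd_iff hm.aestronglyMeasurable]
  refine ⟨Eventually.of_forall fun x =>
    (hint (x.1.last, x.2)).const_mul (D.indicator (fun _ => (1 : ℝ)) x.1), ?_⟩
  have e : (fun x : History S A n × A => ∫ z, ‖D.indicator (fun _ => (1 : ℝ)) x.1 *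
      g ((x.1.last, x.2), z)‖ ∂M.outcomeKernel n x) = fun x =>
      D.indicator (fun _ => (1 : ℝ)) x.1 *
        (fun w : S × A => ∫ z, ‖g (w, z)‖ ∂M.law w) (x.1.last, x.2) := by
    funext x
    simp only [norm_mul, integral_const_mul, outcomeKernel_apply]
    congr 1
    by_cases hx : x.1 ∈ D <;> simp [hx]
  rw [e]
  obtain ⟨C, hC⟩ : ∃ C, ∀ w : S × A, ∫ z, ‖g (w, z)‖ ∂M.law w ≤ C := by
    obtain ⟨C, hC⟩ := (Set.finite_range fun w : S × A => ∫ z, ‖g (w, z)‖ ∂M.law w).bddAbove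
    exact ⟨C, fun w => hC ⟨w, rfl⟩⟩
  have hm' : Measurable (fun x : History S A n × A => D.indicator (fun _ => (1 : ℝ)) x.1 *
      (fun w : S × A => ∫ z, ‖g (w, z)‖ ∂M.law w) (x.1.last, x.2)) :=
    (hI.comp measurable_fst).mul
      ((Measurable.of_discrete (f := fun w : S × A => ∫ z, ‖g (w, z)‖ ∂M.law w)).comp hl)
  refine Integrable.of_bound (C := C) hm'.aestronglyMeasurable (Eventually.of_forall fun x => ?_)
  have h0 : 0 ≤ ∫ z, ‖g ((x.1.last, x.2), z)‖ ∂M.law (x.1.last, x.2) :=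
    integral_nonneg fun _ => norm_nonneg _
  have h1 := hC (x.1.last, x.2)
  by_cases hx : x.1 ∈ D
  · simp only [Set.indicator_of_mem hx, one_mul]
    rwa [Real.norm_of_nonneg h0]
  · simpa [hx] using h0.trans h1

lemma integrable_indicator_mul (s : S) (hD : MeasurableSet D) (hg : Measurable g)
    (hint : ∀ x, Integrable (fun z => g (x, z)) (M.law x)) :
    Integrable (fun ω : Path S A => D.indicator (fun _ => (1 : ℝ)) (ω.history n) *
      g ((ω.state n, ω.action n), ω.outcome n)) (M.pathLaw π s) := by
  have h := integrable_compProd_indicator π s hD hg hint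
  rw [← map_history_action_outcome] at h
  exact h.comp_measurable (((Path.measurable_history n).prodMk (Path.measurable_action n)).prodMk
    (Path.measurable_outcome n))

/-- On an event of the history, the outcome may be replaced by its conditional mean. -/
lemma integral_indicator_mul (s : S) (hD : MeasurableSet D) (hg : Measurable g)
    (hint : ∀ x, Integrable (fun z => g (x, z)) (M.law x)) :
    ∫ ω : Path S A, D.indicator (fun _ => (1 : ℝ)) (ω.history n) *
        g ((ω.state n, ω.action n), ω.outcome n) ∂(M.pathLaw π s) =
      ∫ ω : Path S A, D.indicator (fun _ => (1 : ℝ)) (ω.history n) *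
        (∫ z, g ((ω.state n, ω.action n), z) ∂M.law (ω.state n, ω.action n))
          ∂(M.pathLaw π s) := by
  have h := integrable_compProd_indicator π s hD hg hint
  have hha := (Path.measurable_history (S := S) (A := A) n).prodMk (Path.measurable_action n)
  have e := Measure.integral_compProd h
  have h' := h.aestronglyMeasurable
  rw [← map_history_action_outcome] at e h'
  rw [integral_map (hha.prodMk (Path.measurable_outcome n)).aemeasurable h'] at e
  refine e.trans ?_
  have e2 : (fun x : History S A n × A => ∫ z, D.indicator (fun _ => (1 : ℝ)) x.1 *
      g ((x.1.last, x.2), z) ∂M.outcomeKernel n x) = fun x =>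
      D.indicator (fun _ => (1 : ℝ)) x.1 *
        (fun w : S × A => ∫ z, g (w, z) ∂M.law w) (x.1.last, x.2) := by
    funext x
    simp only [integral_const_mul, outcomeKernel_apply]
  have hl : Measurable fun x : History S A n × A => (x.1.last, x.2) :=
    ((History.measurable_last n).comp measurable_fst).prodMk measurable_snd
  have hm : Measurable (fun x : History S A n × A => D.indicator (fun _ => (1 : ℝ)) x.1 *
      (fun w : S × A => ∫ z, g (w, z) ∂M.law w) (x.1.last, x.2)) :=
    ((measurable_const.indicator hD).comp measurable_fst).mul
      ((Measurable.of_discrete (f := fun w : S × A => ∫ z, g (w, z) ∂M.law w)).comp hl)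
  rw [e2, integral_map hha.aemeasurable hm.aestronglyMeasurable]
  rfl

end OneStep

end PathLaw

/-! ### Stationary policies and sets of states that trajectories cannot leave -/

section Selector

variable {S A : Type u} [MeasurableSpace S] [MeasurableSpace A]
  [Finite S] [MeasurableSingletonClass S]

/-- The stationary deterministic policy which plays `σ s` in state `s`. -/
def Policy.ofSelector (σ : S → A) : Policy S A where
  rule n := Kernel.deterministic (fun h => σ h.last)
    ((Measurable.of_discrete (f := σ)).comp (History.measurable_last n))
  isMarkov _ := inferInstance

variable (M : SMDP S A) (π : Policy S A)

lemma ae_state_zero (s : S) : ∀ᵐ ω ∂(M.pathLaw π s), ω.state 0 = s := by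
  have h : (M.pathLaw π s).map (fun ω => ω.history 0) = Measure.dirac (History.init s) := by
    have h := Kernel.traj_map_frestrictLe_apply (κ := M.stepKernel π) 0 0 (History.init s)
    rw [Kernel.partialTraj_self, Kernel.id_apply] at h
    exact h
  have h2 : ∀ᵐ x ∂((M.pathLaw π s).map fun ω => ω.history 0), x.last = s := by
    rw [h, ae_dirac_iff (p := fun x : History S A 0 => x.last = s)
      (History.measurable_last 0 (measurableSet_singleton s))]
    rfl
  exact ae_of_ae_map (Path.measurable_history 0).aemeasurable h2

lemma ae_action_eq [Finite A] [MeasurableSingletonClass A] (σ : S → A) (s : S) :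
    ∀ᵐ ω ∂(M.pathLaw (Policy.ofSelector σ) s), ∀ n, ω.action n = σ (ω.state n) := by
  rw [ae_all_iff]
  intro n
  have hl : Measurable fun x : History S A n × A => (x.1.last, x.2) :=
    ((History.measurable_last n).comp measurable_fst).prodMk measurable_snd
  have h : ∀ᵐ x ∂((M.pathLaw (Policy.ofSelector σ) s).map fun ω => (ω.history n, ω.action n)),
      x.2 = σ x.1.last := by
    have : IsProbabilityMeasure
        ((M.pathLaw (Policy.ofSelector σ) s).map fun ω => ω.history n) :=
      Measure.isProbabilityMeasure_map (Path.measurable_history n).aemeasurable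
    rw [map_history_action, Measure.ae_compProd_iff
      (p := fun x : History S A n × A => x.2 = σ x.1.last)
      (hl (MeasurableSet.of_discrete (s := {y : S × A | y.2 = σ y.1})))]
    refine Eventually.of_forall fun x => ?_
    change ∀ᵐ b ∂(Kernel.deterministic (fun h : History S A n => σ h.last)
      ((Measurable.of_discrete (f := σ)).comp (History.measurable_last n)) x), b = σ x.last
    rw [Kernel.deterministic_apply, ae_dirac_iff (p := fun b => b = σ x.last)
      (measurableSet_singleton (σ x.last))]
  exact ae_of_ae_map ((Path.measurable_history n).prodMk (Path.measurable_action n)).aemeasurable h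

lemma ae_law_transProb_pos (s : S) (a : A) : ∀ᵐ z ∂(M.law (s, a)), 0 < M.transProb s a z.1 := by
  have h : ∀ s', ∀ᵐ z ∂(M.law (s, a)), z.1 = s' → 0 < M.transProb s a s' := by
    intro s'
    rcases (measureReal_nonneg : 0 ≤ M.transProb s a s').eq_or_lt with h0 | h0
    · have h1 : M.law (s, a) {z | z.1 = s'} = 0 := (measureReal_eq_zero_iff).1 h0.symm
      have h2 : ∀ᵐ z ∂(M.law (s, a)), ¬ z.1 = s' := by simpa [ae_iff] using h1
      filter_upwards [h2] with z hz h3 using absurd h3 hz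
    · exact Eventually.of_forall fun _ _ => h0
  filter_upwards [ae_all_iff.2 h] with z hz using hz _ rfl

variable [Finite A] [MeasurableSingletonClass A]

lemma ae_transProb_pos (s : S) :
    ∀ᵐ ω ∂(M.pathLaw π s), ∀ n, 0 < M.transProb (ω.state n) (ω.action n) (ω.state (n + 1)) := by
  rw [ae_all_iff]
  intro n
  have hl : Measurable fun x : (History S A n × A) × (S × ℝ≥0 × ℝ) =>
      (x.1.1.last, x.1.2, x.2.1) :=
    ((History.measurable_last n).comp (measurable_fst.comp measurable_fst)).prodMk
      ((measurable_snd.comp measurable_fst).prodMk (measurable_fst.comp measurable_snd))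
  have hha := (Path.measurable_history (S := S) (A := A) n).prodMk (Path.measurable_action n)
  have h : ∀ᵐ x ∂((M.pathLaw π s).map fun ω => ((ω.history n, ω.action n), ω.outcome n)),
      0 < M.transProb x.1.1.last x.1.2 x.2.1 := by
    have : IsProbabilityMeasure ((M.pathLaw π s).map fun ω => (ω.history n, ω.action n)) :=
      Measure.isProbabilityMeasure_map hha.aemeasurable
    rw [map_history_action_outcome, Measure.ae_compProd_iff
      (p := fun x : (History S A n × A) × (S × ℝ≥0 × ℝ) => 0 < M.transProb x.1.1.last x.1.2 x.2.1)
      (hl (MeasurableSet.of_discrete (s := {y : S × A × S | 0 < M.transProb y.1 y.2.1 y.2.2})))]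
    exact Eventually.of_forall fun x => M.ae_law_transProb_pos x.1.last x.2
  exact ae_of_ae_map (hha.prodMk (Path.measurable_outcome n)).aemeasurable h

lemma ae_state_mem {Y : Set S} (hY : ∀ s ∈ Y, ∀ a s', 0 < M.transProb s a s' → s' ∈ Y)
    {s : S} (hs : s ∈ Y) : ∀ᵐ ω ∂(M.pathLaw π s), ∀ n, ω.state n ∈ Y := by
  filter_upwards [M.ae_state_zero π s, M.ae_transProb_pos π s] with ω h0 h1 n
  induction n with
  | zero => rwa [h0]
  | succ n ih => exact hY _ ih _ _ (h1 n)

lemma ae_state_mem_ofSelector {σ : S → A} {Y : Set S}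
    (hY : ∀ s ∈ Y, ∀ s', 0 < M.transProb s (σ s) s' → s' ∈ Y) {s : S} (hs : s ∈ Y) :
    ∀ᵐ ω ∂(M.pathLaw (Policy.ofSelector σ) s), ∀ n, ω.state n ∈ Y := by
  filter_upwards [M.ae_state_zero _ s, M.ae_transProb_pos _ s, M.ae_action_eq σ s]
    with ω h0 h1 h2 n
  induction n with
  | zero => rwa [h0]
  | succ n ih => exact hY _ ih _ (h2 n ▸ h1 n)

variable {M π}

/-- A state of `C` outside `Y` could never be reached from `s`, since almost every trajectory from
`s` stays in `Y` under every policy. -/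
lemma IsClosedCommunicatingClass.subset_of_closed {C : Set S}
    (hC : M.IsClosedCommunicatingClass C) {Y : Set S}
    (hY : ∀ s ∈ Y, ∀ a s', 0 < M.transProb s a s' → s' ∈ Y) {s : S} (hs : s ∈ C) (hsY : s ∈ Y) :
    C ⊆ Y := by
  intro s' hs'
  by_contra hn
  obtain ⟨π, n, hpos⟩ := hC.communicating s hs s' hs'
  refine hpos.ne' ?_
  have h : ∀ᵐ ω ∂(M.pathLaw π s), ¬ ω.state n = s' := by
    filter_upwards [M.ae_state_mem π hY hsY] with ω h h2
    exact hn (h2 ▸ h n)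
  simpa [ae_iff] using h

/-- Otherwise some trajectory would spend all of its infinitely many epochs in finitely many states,
each visited finitely often. -/
lemma exists_mem_of_transient {C Y : Set S} (hC : ∀ s ∉ C, M.IsTransientUnder π s) {s : S}
    (h : ∀ᵐ ω ∂(M.pathLaw π s), ∀ n, ω.state n ∈ Y) : ∃ s' ∈ Y, s' ∈ C := by
  by_contra! hYC
  have h1 : ∀ᵐ ω ∂(M.pathLaw π s), ∀ s' ∈ Y, {n : ℕ | ω.state n = s'}.Finite := by
    rw [ae_all_iff]
    intro s'
    by_cases hs' : s' ∈ Y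
    · filter_upwards [hC s' (hYC s' hs') s] with ω hω _ using hω
    · exact Eventually.of_forall fun _ h => absurd h hs'
  obtain ⟨ω, h2, h3⟩ := (h.and h1).exists
  have h4 : (⋃ s' ∈ Y, {n : ℕ | ω.state n = s'}).Finite :=
    (Set.toFinite Y).biUnion h3
  refine Set.infinite_univ (h4.subset fun n _ => ?_)
  simp only [Set.mem_iUnion]
  exact ⟨_, h2 n, rfl⟩

end Selector

/-! ### Weak communication makes solutions of `z = max_a p z` constant -/

section Harmonic

variable {S A : Type u} [Fintype S] [Fintype A] [Nonempty A] [MeasurableSpace S]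
  [MeasurableSpace A] [MeasurableSingletonClass S] [MeasurableSingletonClass A] {M : SMDP S A}

lemma isTransition_transProb (M : SMDP S A) : IsTransition M.transProb where
  nonneg _ _ _ := measureReal_nonneg
  sum_eq_one s a := by
    have : IsProbabilityMeasure ((M.law (s, a)).map Prod.fst) :=
      Measure.isProbabilityMeasure_map measurable_fst.aemeasurable
    have h : ∀ s', M.transProb s a s' = ((M.law (s, a)).map Prod.fst).real {s'} := fun s' => by
      rw [map_measureReal_apply measurable_fst (measurableSet_singleton s')]; rfl
    simp only [h, sum_measureReal_singleton, Finset.coe_univ, probReal_univ]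

lemma WeaklyCommunicating.nonempty (hW : M.WeaklyCommunicating) : Nonempty S := by
  obtain ⟨C, hC, -⟩ := hW
  exact ⟨hC.nonempty.some⟩

/-- In an average with weights `p`, a value equal to an extreme one forces all charged values to be
extreme. -/
lemma IsTransition.eq_of_sum_le {p : S → A → S → ℝ} (hp : IsTransition p) {s : S} {a : A}
    {z : S → ℝ} {c : ℝ} (hz : ∀ s', 0 < p s a s' → c ≤ z s') (h : ∑ s', p s a s' * z s' ≤ c)
    {s' : S} (hs' : 0 < p s a s') : z s' = c := by
  have h0 : ∀ s', 0 ≤ p s a s' * (z s' - c) := fun s' => by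
    rcases (hp.nonneg s a s').eq_or_lt with h1 | h1
    · rw [← h1, zero_mul]
    · exact mul_nonneg h1.le (sub_nonneg.2 (hz s' h1))
  have h1 : ∑ s', p s a s' * (z s' - c) = ∑ s', p s a s' * z s' - c := by
    simp only [mul_sub, Finset.sum_sub_distrib, ← Finset.sum_mul, hp.sum_eq_one, one_mul]
  have h2 := Finset.single_le_sum (fun s' _ => h0 s') (Finset.mem_univ s')
  have h3 : p s a s' * (z s' - c) = 0 := le_antisymm (by linarith) (h0 s')
  rcases mul_eq_zero.1 h3 with h4 | h4
  · exact absurd h4 hs'.ne'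
  · linarith

/-- The maximizers of `z` cannot be left under a maximizing selector, and the minimizers cannot be
left under any action. By transience both sets meet the closed class; the second then contains it,
so the two extreme values agree. -/
theorem WeaklyCommunicating.harmonicConst (hW : M.WeaklyCommunicating) :
    HarmonicConst M.transProb := by
  intro z hz
  have hne := hW.nonempty
  have hp := isTransition_transProb M
  obtain ⟨C, hC, -, htr⟩ := hW
  have hle : ∀ s a, ∑ s', M.transProb s a s' * z s' ≤ z s := fun s a => by
    have := le_maxVal (lookahead M.transProb 0 z) s a
    rw [← bellman, hz] at this
    simpa [lookahead] using this
  have hge : ∀ s, ∃ a, z s = ∑ s', M.transProb s a s' * z s' := fun s => by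
    obtain ⟨a, ha⟩ := exists_maxVal_eq (lookahead M.transProb 0 z) s
    rw [← bellman, hz] at ha
    exact ⟨a, by simpa [lookahead] using ha⟩
  choose σ hσ using hge
  obtain ⟨sM, hsM⟩ := Finite.exists_max z
  obtain ⟨sm, hsm⟩ := Finite.exists_min z
  -- a maximizer in the closed class
  obtain ⟨c₁, hc₁, hc₁C⟩ : ∃ s' ∈ {s | z s = z sM}, s' ∈ C := by
    refine exists_mem_of_transient (fun s hs => htr s hs _)
      (M.ae_state_mem_ofSelector (σ := σ) (s := sM) (fun s hs s' hpos => ?_) rfl)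
    have := hp.eq_of_sum_le (z := fun s => -z s) (c := -z sM) (fun s' _ => neg_le_neg (hsM s'))
      (by simp only [mul_neg, Finset.sum_neg_distrib]; rw [← hσ, hs]) hpos
    exact neg_injective this
  -- a minimizer in the closed class
  obtain ⟨c₂, hc₂, hc₂C⟩ : ∃ s' ∈ {s | z s = z sm}, s' ∈ C := by
    refine exists_mem_of_transient (fun s hs => htr s hs (Policy.ofSelector σ))
      (M.ae_state_mem _ (s := sm) (fun s hs a s' hpos => ?_) rfl)
    exact hp.eq_of_sum_le (fun s' _ => hsm s') ((hle s a).trans_eq hs) hpos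
  have hsub : C ⊆ {s | z s = z sm} := by
    refine hC.subset_of_closed (fun s hs a s' hpos => ?_) hc₂C hc₂
    exact hp.eq_of_sum_le (fun s' _ => hsm s') ((hle s a).trans_eq hs) hpos
  have hMm : z sM = z sm := by
    rw [← hc₁]; exact hsub hc₁C
  have hall : ∀ s, z s = z sm := fun s => le_antisymm ((hsM s).trans_eq hMm) (hsm s)
  exact fun s s' => by rw [hall s, hall s']

end Harmonic

end SMDP

/-- Measurability of `f` is part of the conclusion: it will be applied to sums with a random number
of terms, which are recognised only almost everywhere as series. -/
lemma integrable_of_hasSum_ae {α : Type*} [MeasurableSpace α] {μ : Measure α} {F : ℕ → α → ℝ}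
    {f : α → ℝ} (hF : ∀ i, Integrable (F i) μ) (hs : Summable fun i => ∫ a, ‖F i a‖ ∂μ)
    (hf : ∀ᵐ a ∂μ, HasSum (fun i => F i a) (f a)) :
    Integrable f μ ∧ HasSum (fun i => ∫ a, F i a ∂μ) (∫ a, f a ∂μ) := by
  have hfe : (fun a => ∑' i, F i a) =ᵐ[μ] f := by
    filter_upwards [hf] with a ha using ha.tsum_eq
  refine ⟨⟨?_, ?_⟩, ?_⟩
  · refine aestronglyMeasurable_of_tendsto_ae atTop (f := fun m a => ∑ i ∈ Finset.range m, F i a)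
      (fun m => (integrable_finsetSum _ fun i _ => hF i).aestronglyMeasurable) ?_
    filter_upwards [hf] with a ha using ha.tendsto_sum_nat
  · have h1 : ∀ i, ∫⁻ a, ‖F i a‖ₑ ∂μ = ENNReal.ofReal (∫ a, ‖F i a‖ ∂μ) := fun i =>
      (ofReal_integral_norm_eq_lintegral_enorm (hF i)).symm
    calc ∫⁻ a, ‖f a‖ₑ ∂μ ≤ ∫⁻ a, ∑' i, ‖F i a‖ₑ ∂μ := by
          refine lintegral_mono_ae ?_
          filter_upwards [hf] with a ha
          rw [← ha.tsum_eq]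
          exact enorm_tsum_le_tsum_enorm
      _ = ∑' i, ∫⁻ a, ‖F i a‖ₑ ∂μ :=
          lintegral_tsum fun i => (hF i).aestronglyMeasurable.enorm
      _ < ⊤ := by
          simp only [h1]
          exact hs.tsum_ofReal_ne_top.lt_top
  · rw [← integral_congr_ae hfe]
    exact hasSum_integral_of_summable_integral_norm hF hs

namespace SMDP

/-! ### Pathwise bookkeeping of transition times and overshoot -/

section Time

/-- The time elapsed at the end of a history. -/
def History.time {S A : Type u} {n : ℕ} (h : History S A n) : ℝ :=
  ∑ i : Fin n, ((show A × (S × ℝ≥0 × ℝ) from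
    h ⟨(i : ℕ) + 1, Finset.mem_Iic.2 i.2⟩).2.2.1 : ℝ)

/-- State, action and outcome of the `(n+1)`-st transition. -/
def Path.transition {S A : Type u} (ω : Path S A) (n : ℕ) : (S × A) × (S × ℝ≥0 × ℝ) :=
  ((ω.state n, ω.action n), ω.outcome n)

/-- The indicator of the event `t_n ≤ t`. -/
def Path.alive {S A : Type u} (ω : Path S A) (t : ℝ) (n : ℕ) : ℝ :=
  {h : History S A n | h.time ≤ t}.indicator (fun _ => (1 : ℝ)) (ω.history n)

/-- The sum of `g` over the transitions that begin by time `t`. -/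
def Path.cumul {S A : Type u} (g : (S × A) × (S × ℝ≥0 × ℝ) → ℝ) (t : ℝ) (ω : Path S A) : ℝ :=
  ∑ n ∈ Finset.range (ω.numTransitions t + 1), g (ω.transition n)

section Pathwise

variable {S A : Type u} (ω : Path S A)

lemma Path.time_history (n : ℕ) : (ω.history n).time = ω.transitionTime n :=
  (Finset.sum_range fun i => ω.holdingTime i).symm

lemma Path.holdingTime_nonneg (n : ℕ) : 0 ≤ ω.holdingTime n := NNReal.coe_nonneg _

lemma Path.transitionTime_succ (n : ℕ) :
    ω.transitionTime (n + 1) = ω.transitionTime n + ω.holdingTime n :=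
  Finset.sum_range_succ _ _

lemma Path.transitionTime_mono : Monotone ω.transitionTime :=
  monotone_nat_of_le_succ fun n => by
    rw [ω.transitionTime_succ]; linarith [ω.holdingTime_nonneg n]

lemma Path.alive_eq (t : ℝ) (n : ℕ) : ω.alive t n = if ω.transitionTime n ≤ t then 1 else 0 := by
  simp only [Path.alive, Set.indicator_apply, Set.mem_ofPred_eq, ω.time_history]

lemma Path.alive_nonneg (t : ℝ) (n : ℕ) : 0 ≤ ω.alive t n := by
  rw [ω.alive_eq]; split_ifs <;> norm_num

lemma Path.sum_alive_mul_min_le {t : ℝ} (ht : 0 ≤ t) (m : ℕ) :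
    ∑ n ∈ Finset.range m, ω.alive t n * min (ω.holdingTime n) 1 ≤ t + 1 := by
  -- The induction needs the bound by the elapsed time as well: it is at most `t` when a step is
  -- counted, and a truncated step adds at most one.
  suffices h : ∑ n ∈ Finset.range m, ω.alive t n * min (ω.holdingTime n) 1 ≤
      min (ω.transitionTime m) (t + 1) from h.trans (min_le_right _ _)
  induction m with
  | zero => simp [Path.transitionTime]; linarith
  | succ m ih =>
    have h0 := ω.holdingTime_nonneg m
    rw [Finset.sum_range_succ, ω.transitionTime_succ, ω.alive_eq]
    have h1 := ih.trans (min_le_left _ _)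
    have h2 := ih.trans (min_le_right _ _)
    have h3 := min_le_left (ω.holdingTime m) 1
    have h4 := min_le_right (ω.holdingTime m) 1
    split_ifs with h
    · exact le_min (by linarith) (by linarith)
    · exact le_min (by linarith) (by linarith)

/-- Finiteness excludes infinitely many transitions by time `t`, where the supremum in
`numTransitions` would take its default value `0`. -/
lemma Path.le_numTransitions_iff {t : ℝ} (ht : 0 ≤ t)
    (hfin : {n | ω.transitionTime n ≤ t}.Finite) (n : ℕ) :
    n ≤ ω.numTransitions t ↔ ω.transitionTime n ≤ t := by
  have hne : {n | ω.transitionTime n ≤ t}.Nonempty := ⟨0, by simpa [Path.transitionTime] using ht⟩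
  constructor
  · intro h
    exact (ω.transitionTime_mono h).trans (Nat.sSup_mem hne hfin.bddAbove)
  · intro h
    exact le_csSup hfin.bddAbove h

lemma Path.hasSum_alive_mul {t : ℝ} (ht : 0 ≤ t) (hfin : {n | ω.transitionTime n ≤ t}.Finite)
    (g : (S × A) × (S × ℝ≥0 × ℝ) → ℝ) :
    HasSum (fun n => ω.alive t n * g (ω.transition n)) (Path.cumul g t ω) := by
  have h : Path.cumul g t ω = ∑ n ∈ Finset.range (ω.numTransitions t + 1),
      ω.alive t n * g (ω.transition n) := by
    refine Finset.sum_congr rfl fun n hn => ?_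
    rw [ω.alive_eq, if_pos ((ω.le_numTransitions_iff ht hfin n).1
      (Nat.lt_succ_iff.1 (Finset.mem_range.1 hn))), one_mul]
  rw [h]
  refine hasSum_sum_of_ne_finset_zero fun n hn => ?_
  rw [ω.alive_eq, if_neg, zero_mul]
  rw [← ω.le_numTransitions_iff ht hfin n]
  intro h
  exact hn (Finset.mem_range.2 (Nat.lt_succ_of_le h))

lemma Path.hasSum_totalReward {t : ℝ} (ht : 0 ≤ t) (hfin : {n | ω.transitionTime n ≤ t}.Finite) :
    HasSum (fun n => ω.alive t (n + 1) * ω.reward n) (ω.totalReward t) := by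
  have h : ω.totalReward t = ∑ n ∈ Finset.range (ω.numTransitions t),
      ω.alive t (n + 1) * ω.reward n := by
    refine Finset.sum_congr rfl fun n hn => ?_
    rw [ω.alive_eq, if_pos ((ω.le_numTransitions_iff ht hfin (n + 1)).1
      (Finset.mem_range.1 hn)), one_mul]
  rw [h]
  refine hasSum_sum_of_ne_finset_zero fun n hn => ?_
  rw [ω.alive_eq, if_neg, zero_mul]
  rw [← ω.le_numTransitions_iff ht hfin (n + 1)]
  intro h
  exact hn (Finset.mem_range.2 h)

/-- The overshoot estimate: up to the last transition and a bounded term, the total reward is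
`ρ t` plus the accumulated increments of `R - ρ τ + v`. -/
lemma Path.abs_totalReward_sub_le {t : ℝ} (ht : 0 ≤ t)
    (hfin : {n | ω.transitionTime n ≤ t}.Finite) {v : S → ℝ} {V : ℝ} (hV : ∀ s, |v s| ≤ V)
    (ρ : ℝ) {η : ℝ} (hη : 0 < η) :
    |ω.totalReward t - ρ * t -
        Path.cumul (fun y => y.2.2.2 - ρ * (y.2.2.1 : ℝ) + (v y.2.1 - v y.1.1)) t ω| ≤
      η * Path.cumul (fun y => y.2.2.2 ^ 2 + |ρ| * (y.2.2.1 : ℝ) ^ 2) t ω +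
        (1 + |ρ|) * (1 / (4 * η)) + 2 * V := by
  set N := ω.numTransitions t with hN
  -- `cumul` also counts the transition in progress at time `t`, hence the extra reward and the
  -- index `N + 1`; the differences of `v` telescope.
  have h1 : Path.cumul (fun y => y.2.2.2 - ρ * (y.2.2.1 : ℝ) + (v y.2.1 - v y.1.1)) t ω =
      ω.totalReward t + ω.reward N - ρ * ω.transitionTime (N + 1) +
        (v (ω.state (N + 1)) - v (ω.state 0)) := by
    have e1 : ∑ n ∈ Finset.range (N + 1), (v (ω.state (n + 1)) - v (ω.state n)) =
        v (ω.state (N + 1)) - v (ω.state 0) := Finset.sum_range_sub (fun n => v (ω.state n)) _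
    have e2 : ∑ n ∈ Finset.range (N + 1), ω.reward n = ω.totalReward t + ω.reward N :=
      Finset.sum_range_succ _ _
    rw [← e1, ← e2, Path.transitionTime, Finset.mul_sum, ← Finset.sum_sub_distrib,
      ← Finset.sum_add_distrib]
    rfl
  have h2 : ω.transitionTime N ≤ t := (ω.le_numTransitions_iff ht hfin N).1 le_rfl
  have h3 : t < ω.transitionTime (N + 1) := by
    rw [← not_le, ← ω.le_numTransitions_iff ht hfin (N + 1)]
    exact Nat.not_succ_le_self N
  -- The transition straddling `t` has a biased law, so its square is dominated by the sum of all
  -- the squares, which Wald's identity can control.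
  have h4 : ω.reward N ^ 2 + |ρ| * ω.holdingTime N ^ 2 ≤
      Path.cumul (fun y => y.2.2.2 ^ 2 + |ρ| * (y.2.2.1 : ℝ) ^ 2) t ω := by
    refine Finset.single_le_sum
      (f := fun n => ω.reward n ^ 2 + |ρ| * ω.holdingTime n ^ 2) (fun n _ => ?_)
      (Finset.mem_range.2 (Nat.lt_succ_self N))
    positivity
  have amgm : ∀ x : ℝ, |x| ≤ η * x ^ 2 + 1 / (4 * η) := by
    intro x
    have : η * x ^ 2 + 1 / (4 * η) - |x| = η * (|x| - 1 / (2 * η)) ^ 2 := by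
      rw [← sq_abs x]; field_simp; ring
    have h0 : 0 ≤ η * (|x| - 1 / (2 * η)) ^ 2 := by positivity
    linarith
  have h5 := amgm (ω.reward N)
  have h6 := amgm (ω.holdingTime N)
  have h7 := ω.holdingTime_nonneg N
  rw [abs_of_nonneg h7] at h6
  rw [ω.transitionTime_succ] at h3 h1
  have h8 : |ρ * (ω.transitionTime N + ω.holdingTime N - t)| ≤
      |ρ| * (η * ω.holdingTime N ^ 2 + 1 / (4 * η)) := by
    rw [abs_mul]
    refine mul_le_mul_of_nonneg_left ?_ (abs_nonneg ρ)
    rw [abs_of_nonneg (by linarith)]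
    linarith
  have h9 := mul_le_mul_of_nonneg_left h4 hη.le
  have e : ω.totalReward t - ρ * t - (ω.totalReward t + ω.reward N -
      ρ * (ω.transitionTime N + ω.holdingTime N) + (v (ω.state (N + 1)) - v (ω.state 0))) =
      -ω.reward N + ρ * (ω.transitionTime N + ω.holdingTime N - t) +
        (v (ω.state 0) - v (ω.state (N + 1))) := by ring
  rw [h1, e]
  have h10 := abs_add_three (-ω.reward N) (ρ * (ω.transitionTime N + ω.holdingTime N - t))
    (v (ω.state 0) - v (ω.state (N + 1)))
  have h11 := abs_sub (v (ω.state 0)) (v (ω.state (N + 1)))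
  rw [abs_neg] at h10
  linarith [hV (ω.state 0), hV (ω.state (N + 1))]

end Pathwise

variable {S A : Type u} [MeasurableSpace S] [MeasurableSpace A]

lemma History.measurable_time (n : ℕ) : Measurable (History.time (S := S) (A := A) (n := n)) := by
  refine Finset.measurable_fun_sum _ fun i _ => ?_
  have h : Measurable fun h : History S A n => (show A × (S × ℝ≥0 × ℝ) from
      h ⟨(i : ℕ) + 1, Finset.mem_Iic.2 i.2⟩) := measurable_pi_apply _
  exact measurable_coe_nnreal_real.comp
    (measurable_fst.comp (measurable_snd.comp (measurable_snd.comp h)))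

lemma History.measurableSet_time_le (n : ℕ) (t : ℝ) :
    MeasurableSet {h : History S A n | h.time ≤ t} :=
  measurableSet_le (History.measurable_time n) measurable_const

lemma Path.measurable_alive (t : ℝ) (n : ℕ) : Measurable fun ω : Path S A => ω.alive t n :=
  (measurable_const.indicator (History.measurableSet_time_le n t)).comp (Path.measurable_history n)

lemma Path.measurable_reward (n : ℕ) : Measurable fun ω : Path S A => ω.reward n :=
  measurable_snd.comp (measurable_snd.comp (Path.measurable_outcome n))

end Time

/-! ### Expected number of transitions and Wald's identity -/

section Wald

variable {S A : Type u} [MeasurableSpace S] [MeasurableSpace A] [Finite S] [Finite A]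
  [MeasurableSingletonClass S] [MeasurableSingletonClass A] {M : SMDP S A}

/-- The conditional mean of `g` given state and action. -/
def mean (M : SMDP S A) (g : (S × A) × (S × ℝ≥0 × ℝ) → ℝ) (x : S × A) : ℝ :=
  ∫ z, g (x, z) ∂M.law x

lemma Regular.integrable_time (hM : M.Regular) (x : S × A) :
    Integrable (fun z : S × ℝ≥0 × ℝ => (z.2.1 : ℝ)) (M.law x) :=
  ((memLp_two_iff_integrable_sq (by fun_prop)).2 (hM.time_sq x.1 x.2)).integrable (by norm_num)

lemma Regular.integrable_reward (hM : M.Regular) (x : S × A) :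
    Integrable (fun z : S × ℝ≥0 × ℝ => z.2.2) (M.law x) :=
  ((memLp_two_iff_integrable_sq (by fun_prop)).2 (hM.reward_sq x.1 x.2)).integrable (by norm_num)

lemma Regular.integrable_min_time (hM : M.Regular) (x : S × A) :
    Integrable (fun z : S × ℝ≥0 × ℝ => min (z.2.1 : ℝ) 1) (M.law x) :=
  (hM.integrable_time x).inf (integrable_const 1)

/-- A zero mean would force `τ = 0` almost surely, against the holding-time condition; finiteness of
the state-action pairs makes the bound uniform. -/
lemma Regular.exists_mean_min_time (hM : M.Regular) :
    ∃ δ : ℝ, 0 < δ ∧ ∀ x, δ ≤ M.mean (fun y => min (y.2.2.1 : ℝ) 1) x := by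
  obtain ⟨ε, hε, h⟩ := hM.holding
  have hpos : ∀ x, 0 < M.mean (fun y => min (y.2.2.1 : ℝ) 1) x := by
    intro x
    have h0 : 0 ≤ fun z : S × ℝ≥0 × ℝ => min (z.2.1 : ℝ) 1 := fun z =>
      le_min (NNReal.coe_nonneg _) zero_le_one
    refine (integral_nonneg h0).lt_of_ne fun h1 => (h x.1 x.2).ne ?_
    have h2 := (integral_eq_zero_iff_of_nonneg h0 (hM.integrable_min_time x)).1 h1.symm
    have h3 : ∀ᵐ z ∂(M.law x), (z.2.1 : ℝ) ≤ ε := by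
      filter_upwards [h2] with z hz
      have hz : min (z.2.1 : ℝ) 1 = 0 := hz
      rcases min_choice (z.2.1 : ℝ) 1 with h4 | h4
      · rw [← h4, hz]; exact hε.le
      · rw [h4] at hz; norm_num at hz
    rw [prob_compl_eq_zero_iff (measurableSet_le (by fun_prop) measurable_const) |>.symm]
    exact h3
  rcases isEmpty_or_nonempty (S × A) with he | hne
  · exact ⟨1, one_pos, fun x => he.elim x⟩
  · obtain ⟨x₀, hx₀⟩ := Finite.exists_min (M.mean fun y => min (y.2.2.1 : ℝ) 1)
    exact ⟨_, hpos x₀, hx₀⟩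

lemma Regular.meanTime_pos (hM : M.Regular) (s : S) (a : A) : 0 < M.meanTime s a := by
  obtain ⟨δ, hδ, h⟩ := hM.exists_mean_min_time
  exact hδ.trans_le ((h (s, a)).trans (integral_mono (hM.integrable_min_time _)
    (hM.integrable_time _) fun z => min_le_left _ _))

variable (π : Policy S A) (s : S) {g : (S × A) × (S × ℝ≥0 × ℝ) → ℝ} {t δ : ℝ}

lemma integrable_alive_mul (t : ℝ) (n : ℕ) (hg : Measurable g)
    (hint : ∀ x, Integrable (fun z => g (x, z)) (M.law x)) :
    Integrable (fun ω : Path S A => ω.alive t n * g (ω.transition n)) (M.pathLaw π s) :=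
  integrable_indicator_mul π s (History.measurableSet_time_le n t) hg hint

lemma integrable_alive (t : ℝ) (n : ℕ) :
    Integrable (fun ω : Path S A => ω.alive t n) (M.pathLaw π s) := by
  simpa using integrable_alive_mul (M := M) π s t n (g := fun _ => 1) measurable_const
    (fun _ => integrable_const 1)

lemma integral_alive_mul (t : ℝ) (n : ℕ) (hg : Measurable g)
    (hint : ∀ x, Integrable (fun z => g (x, z)) (M.law x)) :
    ∫ ω : Path S A, ω.alive t n * g (ω.transition n) ∂(M.pathLaw π s) =
      ∫ ω : Path S A, ω.alive t n * M.mean g (ω.transition n).1 ∂(M.pathLaw π s) :=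
  integral_indicator_mul π s (History.measurableSet_time_le n t) hg hint

lemma integrable_alive_mul_mean (t : ℝ) (n : ℕ) (G : S × A → ℝ) :
    Integrable (fun ω : Path S A => ω.alive t n * G (ω.transition n).1) (M.pathLaw π s) :=
  integrable_alive_mul (M := M) π s t n (g := fun y => G y.1)
    (Measurable.of_discrete.comp measurable_fst) (fun x => integrable_const (G x))

lemma integral_alive_mul_le (t : ℝ) (n : ℕ) (hg : Measurable g)
    (hint : ∀ x, Integrable (fun z => g (x, z)) (M.law x)) {C : ℝ} (hC : ∀ x, M.mean g x ≤ C) :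
    ∫ ω : Path S A, ω.alive t n * g (ω.transition n) ∂(M.pathLaw π s) ≤
      C * ∫ ω : Path S A, ω.alive t n ∂(M.pathLaw π s) := by
  rw [integral_alive_mul π s t n hg hint, ← integral_const_mul]
  refine integral_mono (integrable_alive_mul_mean π s t n _)
    ((integrable_alive π s t n).const_mul C) fun ω => ?_
  simp only
  rw [mul_comm C]
  exact mul_le_mul_of_nonneg_left (hC _) (ω.alive_nonneg t n)

/-- Each transition begun by time `t` uses at least `δ` of truncated time in conditional mean, and
the truncated times add up to at most `t + 1`. So the expected number of transitions grows at most
linearly. -/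
lemma sum_integral_alive_le (hM : M.Regular) (hδ : 0 < δ)
    (h : ∀ x, δ ≤ M.mean (fun y => min (y.2.2.1 : ℝ) 1) x) (ht : 0 ≤ t) (m : ℕ) :
    ∑ n ∈ Finset.range m, ∫ ω : Path S A, ω.alive t n ∂(M.pathLaw π s) ≤ (t + 1) / δ := by
  have hg : Measurable fun y : (S × A) × (S × ℝ≥0 × ℝ) => min (y.2.2.1 : ℝ) 1 := by fun_prop
  have hI := fun n => integrable_alive_mul (M := M) π s t n hg fun x => hM.integrable_min_time x
  have h1 : ∀ n, δ * ∫ ω : Path S A, ω.alive t n ∂(M.pathLaw π s) ≤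
      ∫ ω : Path S A, ω.alive t n * min (ω.holdingTime n) 1 ∂(M.pathLaw π s) := by
    intro n
    have e := integral_alive_mul (M := M) π s t n hg fun x => hM.integrable_min_time x
    refine le_trans ?_ e.ge
    rw [← integral_const_mul]
    refine integral_mono ((integrable_alive π s t n).const_mul δ)
      (integrable_alive_mul_mean π s t n _) fun ω => ?_
    simp only
    rw [mul_comm δ]
    exact mul_le_mul_of_nonneg_left (h _) (ω.alive_nonneg t n)
  rw [le_div_iff₀ hδ, mul_comm, Finset.mul_sum]
  calc ∑ n ∈ Finset.range m, δ * ∫ ω : Path S A, ω.alive t n ∂(M.pathLaw π s)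
      ≤ ∑ n ∈ Finset.range m,
          ∫ ω : Path S A, ω.alive t n * min (ω.holdingTime n) 1 ∂(M.pathLaw π s) :=
        Finset.sum_le_sum fun n _ => h1 n
    _ = ∫ ω : Path S A, ∑ n ∈ Finset.range m, ω.alive t n * min (ω.holdingTime n) 1
          ∂(M.pathLaw π s) := (integral_finsetSum _ fun n _ => hI n).symm
    _ ≤ ∫ _ : Path S A, (t + 1) ∂(M.pathLaw π s) :=
        integral_mono (integrable_finsetSum _ fun n _ => hI n) (integrable_const _)
          fun ω => ω.sum_alive_mul_min_le ht m
    _ = t + 1 := by simp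

lemma integral_alive_nonneg (t : ℝ) (n : ℕ) :
    0 ≤ ∫ ω : Path S A, ω.alive t n ∂(M.pathLaw π s) :=
  integral_nonneg fun ω => ω.alive_nonneg t n

lemma summable_integral_alive (hM : M.Regular) (ht : 0 ≤ t) :
    Summable fun n => ∫ ω : Path S A, ω.alive t n ∂(M.pathLaw π s) := by
  obtain ⟨δ, hδ, h⟩ := hM.exists_mean_min_time
  exact summable_of_sum_range_le (integral_alive_nonneg π s t)
    (sum_integral_alive_le π s hM hδ h ht)

/-- Borel-Cantelli: the probabilities of `t_n ≤ t` are summable. -/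
lemma ae_finite_transitionTime_le (hM : M.Regular) (ht : 0 ≤ t) :
    ∀ᵐ ω ∂(M.pathLaw π s), {n | ω.transitionTime n ≤ t}.Finite := by
  have h : ∀ n, (M.pathLaw π s) {ω | (ω.history n).time ≤ t} =
      ENNReal.ofReal (∫ ω : Path S A, ω.alive t n ∂(M.pathLaw π s)) := by
    intro n
    have hm : MeasurableSet {ω : Path S A | (ω.history n).time ≤ t} :=
      Path.measurable_history n (History.measurableSet_time_le n t)
    have e : (fun ω : Path S A => ω.alive t n) =
        {ω : Path S A | (ω.history n).time ≤ t}.indicator 1 := rfl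
    rw [e, integral_indicator_one hm, ofReal_measureReal]
  have h2 := ae_finite_setOfPred_mem (μ := M.pathLaw π s)
    (s := fun n => {ω : Path S A | (ω.history n).time ≤ t}) (by
      simp only [h]
      exact (summable_integral_alive π s hM ht).tsum_ofReal_ne_top)
  filter_upwards [h2] with ω hω
  simpa only [Set.mem_ofPred_eq, ω.time_history] using hω

lemma cumul_integrable_hasSum (hM : M.Regular) (ht : 0 ≤ t) (hg : Measurable g)
    (hint : ∀ x, Integrable (fun z => g (x, z)) (M.law x)) :
    Integrable (Path.cumul g t) (M.pathLaw π s) ∧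
      HasSum (fun n => ∫ ω : Path S A, ω.alive t n * g (ω.transition n) ∂(M.pathLaw π s))
        (∫ ω, Path.cumul g t ω ∂(M.pathLaw π s)) := by
  obtain ⟨C, hC⟩ : ∃ C, ∀ x, M.mean (fun y => ‖g y‖) x ≤ C := by
    obtain ⟨C, hC⟩ := (Set.finite_range (M.mean fun y => ‖g y‖)).bddAbove
    exact ⟨C, fun x => hC ⟨x, rfl⟩⟩
  refine integrable_of_hasSum_ae (fun n => integrable_alive_mul π s t n hg hint) ?_ ?_
  · refine Summable.of_nonneg_of_le (fun n => integral_nonneg fun _ => norm_nonneg _) (fun n => ?_)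
      ((summable_integral_alive π s hM ht).mul_left C)
    simp only [norm_mul, Real.norm_of_nonneg (Path.alive_nonneg _ t n)]
    exact integral_alive_mul_le π s t n hg.norm (fun x => (hint x).norm) hC
  · filter_upwards [ae_finite_transitionTime_le π s hM ht] with ω hω
    exact ω.hasSum_alive_mul ht hω g

/-- Wald's identity. -/
lemma integral_cumul (hM : M.Regular) (ht : 0 ≤ t) (hg : Measurable g)
    (hint : ∀ x, Integrable (fun z => g (x, z)) (M.law x)) :
    ∫ ω, Path.cumul g t ω ∂(M.pathLaw π s) =
      ∫ ω, Path.cumul (fun y => M.mean g y.1) t ω ∂(M.pathLaw π s) := by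
  have h1 := (cumul_integrable_hasSum π s hM ht hg hint).2
  have h2 := (cumul_integrable_hasSum (M := M) π s hM ht (g := fun y => M.mean g y.1)
    ((Measurable.of_discrete (f := M.mean g)).comp measurable_fst)
    (fun x => integrable_const (M.mean g x))).2
  simp only [integral_alive_mul π s t _ hg hint] at h1
  exact h1.unique h2

lemma integral_cumul_le (hM : M.Regular) (hδ : 0 < δ)
    (h : ∀ x, δ ≤ M.mean (fun y => min (y.2.2.1 : ℝ) 1) x) (ht : 0 ≤ t) (hg : Measurable g)
    (hint : ∀ x, Integrable (fun z => g (x, z)) (M.law x)) {C : ℝ} (hC0 : 0 ≤ C)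
    (hC : ∀ x, M.mean g x ≤ C) :
    ∫ ω, Path.cumul g t ω ∂(M.pathLaw π s) ≤ C * ((t + 1) / δ) := by
  have h1 := (cumul_integrable_hasSum π s hM ht hg hint).2
  refine le_of_tendsto' h1.tendsto_sum_nat fun m => ?_
  calc _ ≤ ∑ n ∈ Finset.range m, C * ∫ ω : Path S A, ω.alive t n ∂(M.pathLaw π s) :=
        Finset.sum_le_sum fun n _ => integral_alive_mul_le π s t n hg hint hC
    _ ≤ C * ((t + 1) / δ) := by
        rw [← Finset.mul_sum]
        exact mul_le_mul_of_nonneg_left (sum_integral_alive_le π s hM hδ h ht m) hC0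

/-- Obtained as an almost everywhere limit of finite sums, which avoids measurability of
`numTransitions`. -/
lemma aestronglyMeasurable_totalReward (hM : M.Regular) (ht : 0 ≤ t) :
    AEStronglyMeasurable (fun ω : Path S A => ω.totalReward t) (M.pathLaw π s) := by
  refine aestronglyMeasurable_of_tendsto_ae atTop
    (f := fun m (ω : Path S A) => ∑ n ∈ Finset.range m, ω.alive t (n + 1) * ω.reward n)
    (fun m => (Finset.measurable_fun_sum _ fun n _ => (Path.measurable_alive t (n + 1)).mul
      (Path.measurable_reward n)).aestronglyMeasurable) ?_
  filter_upwards [ae_finite_transitionTime_le π s hM ht] with ω hω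
  exact (ω.hasSum_totalReward ht hω).tendsto_sum_nat

end Wald

/-! ### Identification of the rate with the optimal reward rate -/

section Verification

variable {S A : Type u} [MeasurableSpace S] [MeasurableSpace A] [Fintype S] [Fintype A]
  [MeasurableSingletonClass S] [MeasurableSingletonClass A] {M : SMDP S A}

/-- The increment `R - ρ τ + v(s') - v(s)` of a transition. -/
def increment (ρ : ℝ) (v : S → ℝ) (y : (S × A) × (S × ℝ≥0 × ℝ)) : ℝ :=
  y.2.2.2 - ρ * (y.2.2.1 : ℝ) + (v y.2.1 - v y.1.1)

/-- The quadratic weight `R² + |ρ| τ²` of a transition. -/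
def overshoot (ρ : ℝ) (y : (S × A) × (S × ℝ≥0 × ℝ)) : ℝ :=
  y.2.2.2 ^ 2 + |ρ| * (y.2.2.1 : ℝ) ^ 2

lemma measurable_increment (ρ : ℝ) (v : S → ℝ) :
    Measurable (increment (A := A) ρ v) := by
  have hv : Measurable v := Measurable.of_discrete
  unfold increment
  fun_prop

lemma measurable_overshoot (ρ : ℝ) : Measurable (overshoot (S := S) (A := A) ρ) := by
  unfold overshoot
  fun_prop

lemma integrable_law_state (v : S → ℝ) (x : S × A) :
    Integrable (fun z : S × ℝ≥0 × ℝ => v z.1) (M.law x) :=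
  (Integrable.of_finite (f := v) (μ := (M.law x).map Prod.fst)).comp_measurable measurable_fst

lemma integral_law_state (v : S → ℝ) (s : S) (a : A) :
    ∫ z, v z.1 ∂(M.law (s, a)) = ∑ s', M.transProb s a s' * v s' := by
  have h : ∀ s', M.transProb s a s' = ((M.law (s, a)).map Prod.fst).real {s'} := fun s' => by
    rw [map_measureReal_apply measurable_fst (measurableSet_singleton s')]; rfl
  have hv : Measurable v := Measurable.of_discrete
  rw [← integral_map (φ := Prod.fst) (f := v) measurable_fst.aemeasurable hv.aestronglyMeasurable,
    integral_fintype .of_finite]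
  simp only [h, smul_eq_mul]

lemma Regular.integrable_increment (hM : M.Regular) (ρ : ℝ) (v : S → ℝ) (x : S × A) :
    Integrable (fun z => increment ρ v (x, z)) (M.law x) :=
  ((hM.integrable_reward x).sub ((hM.integrable_time x).const_mul ρ)).add
    ((integrable_law_state v x).sub (integrable_const (v x.1)))

lemma Regular.integrable_overshoot (hM : M.Regular) (ρ : ℝ) (x : S × A) :
    Integrable (fun z => overshoot ρ (x, z)) (M.law x) :=
  (hM.reward_sq x.1 x.2).add ((hM.time_sq x.1 x.2).const_mul |ρ|)

/-- The bridge to dynamic programming: if `(ρ, v)` solves the optimality equation, these means are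
nonpositive and vanish at maximizing actions. -/
lemma Regular.mean_increment (hM : M.Regular) (ρ : ℝ) (v : S → ℝ) (s : S) (a : A) :
    M.mean (increment ρ v) (s, a) =
      lookahead M.transProb (fun s a => M.meanReward s a - M.meanTime s a * ρ) v (s, a) - v s := by
  have h1 := hM.integrable_reward (s, a)
  have h2 := (hM.integrable_time (s, a)).const_mul ρ
  have h3 := integrable_law_state (M := M) v (s, a)
  have h4 : Integrable (fun _ : S × ℝ≥0 × ℝ => v s) (M.law (s, a)) := integrable_const _
  have h12 : Integrable (fun z : S × ℝ≥0 × ℝ => z.2.2 - ρ * (z.2.1 : ℝ)) (M.law (s, a)) :=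
    h1.sub h2
  have h34 : Integrable (fun z : S × ℝ≥0 × ℝ => v z.1 - v s) (M.law (s, a)) := h3.sub h4
  simp only [mean, increment, lookahead]
  rw [integral_add h12 h34, integral_sub h1 h2, integral_sub h3 h4,
    integral_const_mul, integral_law_state]
  simp only [integral_const, probReal_univ, smul_eq_mul, one_mul, meanReward, meanTime]
  ring

/-- The expected total reward is `ρ t` plus the expected accumulated increments, up to
`O(√(t + 1))`. -/
lemma Regular.exists_abs_integral_totalReward_le (hM : M.Regular) (π : Policy S A) (s : S)
    (ρ : ℝ) (v : S → ℝ) :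
    ∃ K : ℝ, ∀ t : ℝ, 0 ≤ t →
      |∫ ω, ω.totalReward t ∂(M.pathLaw π s) - ρ * t -
        ∫ ω, Path.cumul (fun y => M.mean (increment ρ v) y.1) t ω ∂(M.pathLaw π s)| ≤
      K * √(t + 1) := by
  obtain ⟨δ, hδ, hδm⟩ := hM.exists_mean_min_time
  obtain ⟨C, hC⟩ : ∃ C, ∀ x, M.mean (overshoot ρ) x ≤ C := by
    obtain ⟨C, hC⟩ := (Set.finite_range (M.mean (overshoot ρ))).bddAbove
    exact ⟨C, fun x => hC ⟨x, rfl⟩⟩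
  set V := ‖v‖
  have hV : ∀ s, |v s| ≤ V := fun s => by simpa using norm_le_pi_norm v s
  refine ⟨|C| / δ + (1 + |ρ|) / 4 + 2 * V, fun t ht => ?_⟩
  set w := √(t + 1)
  have hw1 : 1 ≤ w := Real.one_le_sqrt.2 (by linarith)
  have hw0 : 0 < w := by linarith
  have hw2 : w * w = t + 1 := Real.mul_self_sqrt (by linarith)
  have hIX := (cumul_integrable_hasSum π s hM ht (measurable_increment ρ v)
    (hM.integrable_increment ρ v)).1
  have hIY := (cumul_integrable_hasSum π s hM ht (measurable_overshoot ρ)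
    (hM.integrable_overshoot ρ)).1
  -- The overshoot estimate with `η = 1 / w` balances the term `η · O(t + 1)` against `O(1 / η)`;
  -- both become of order `√(t + 1)`.
  have hpath : ∀ᵐ ω ∂(M.pathLaw π s),
      ‖ω.totalReward t - ρ * t - Path.cumul (increment ρ v) t ω‖ ≤
        1 / w * Path.cumul (overshoot ρ) t ω + ((1 + |ρ|) * (1 / (4 * (1 / w))) + 2 * V) := by
    filter_upwards [ae_finite_transitionTime_le π s hM ht] with ω hω
    rw [← add_assoc]
    exact ω.abs_totalReward_sub_le ht hω hV ρ (one_div_pos.2 hw0)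
  have hIB : Integrable (fun ω => 1 / w * Path.cumul (overshoot ρ) t ω +
      ((1 + |ρ|) * (1 / (4 * (1 / w))) + 2 * V)) (M.pathLaw π s) :=
    (hIY.const_mul _).add (integrable_const _)
  have hID : Integrable (fun ω : Path S A => ω.totalReward t - ρ * t -
      Path.cumul (increment ρ v) t ω) (M.pathLaw π s) :=
    hIB.mono' (((aestronglyMeasurable_totalReward π s hM ht).sub
      aestronglyMeasurable_const).sub hIX.aestronglyMeasurable) hpath
  have hIT : Integrable (fun ω : Path S A => ω.totalReward t) (M.pathLaw π s) := by
    refine ((hID.add hIX).add (integrable_const (ρ * t))).congr (Eventually.of_forall fun ω => ?_)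
    simp only [Pi.add_apply]
    ring
  have e : ∫ ω : Path S A, (ω.totalReward t - ρ * t - Path.cumul (increment ρ v) t ω)
      ∂(M.pathLaw π s) = ∫ ω, ω.totalReward t ∂(M.pathLaw π s) - ρ * t -
        ∫ ω, Path.cumul (fun y => M.mean (increment ρ v) y.1) t ω ∂(M.pathLaw π s) := by
    have hIT' : Integrable (fun ω : Path S A => ω.totalReward t - ρ * t) (M.pathLaw π s) :=
      hIT.sub (integrable_const _)
    rw [integral_sub hIT' hIX, integral_sub hIT (integrable_const _),
      integral_cumul π s hM ht (measurable_increment ρ v) (hM.integrable_increment ρ v)]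
    simp
  rw [← e]
  have hYle := integral_cumul_le π s hM hδ hδm ht (measurable_overshoot ρ)
    (hM.integrable_overshoot ρ) (abs_nonneg C) (fun x => (hC x).trans (le_abs_self C))
  calc |∫ ω : Path S A, (ω.totalReward t - ρ * t - Path.cumul (increment ρ v) t ω)
        ∂(M.pathLaw π s)|
      ≤ ∫ ω, (1 / w * Path.cumul (overshoot ρ) t ω +
          ((1 + |ρ|) * (1 / (4 * (1 / w))) + 2 * V)) ∂(M.pathLaw π s) :=
        norm_integral_le_of_norm_le hIB hpath
    _ = 1 / w * ∫ ω, Path.cumul (overshoot ρ) t ω ∂(M.pathLaw π s) +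
          ((1 + |ρ|) * (1 / (4 * (1 / w))) + 2 * V) := by
        rw [integral_add (hIY.const_mul _) (integrable_const _), integral_const_mul]
        simp
    _ ≤ 1 / w * (|C| * (w * w / δ)) + ((1 + |ρ|) * (1 / (4 * (1 / w))) + 2 * V) := by
        rw [hw2]
        gcongr
    _ = |C| / δ * w + (1 + |ρ|) / 4 * w + 2 * V := by
        field_simp
        ring
    _ ≤ (|C| / δ + (1 + |ρ|) / 4 + 2 * V) * w := by
        have : 0 ≤ V := norm_nonneg v
        nlinarith

lemma tendsto_mul_sqrt_add_one_div (K : ℝ) :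
    Tendsto (fun t : ℝ => t⁻¹ * (K * √(t + 1))) atTop (𝓝 0) := by
  have h1 : Tendsto (fun t : ℝ => (√t)⁻¹) atTop (𝓝 0) :=
    tendsto_inv_atTop_zero.comp Real.tendsto_sqrt_atTop
  have h2 : Tendsto (fun t : ℝ => |K| * √2 * (√t)⁻¹) atTop (𝓝 0) := by
    simpa using h1.const_mul (|K| * √2)
  refine squeeze_zero_norm' ?_ h2
  filter_upwards [eventually_ge_atTop 1] with t ht
  have ht0 : 0 < t := by linarith
  have h3 : √(t + 1) ≤ √2 * √t := by
    rw [← Real.sqrt_mul (by norm_num)]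
    exact Real.sqrt_le_sqrt (by linarith)
  have h4 : t⁻¹ * √t = (√t)⁻¹ := by
    have : √t ≠ 0 := (Real.sqrt_pos.2 ht0).ne'
    nth_rewrite 1 [← Real.mul_self_sqrt ht0.le]
    field_simp
  rw [norm_mul, norm_mul, Real.norm_of_nonneg (inv_nonneg.2 ht0.le),
    Real.norm_of_nonneg (Real.sqrt_nonneg _), Real.norm_eq_abs]
  calc t⁻¹ * (|K| * √(t + 1)) ≤ t⁻¹ * (|K| * (√2 * √t)) := by gcongr
    _ = |K| * √2 * (t⁻¹ * √t) := by ring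
    _ = _ := by rw [h4]

/-- Holds for arbitrary `ρ` and `v`; comparing a policy with `ρ` is thereby reduced to the sign of
the mean increments. -/
lemma Regular.tendsto_rate_sub (hM : M.Regular) (π : Policy S A) (s : S) (ρ : ℝ) (v : S → ℝ) :
    Tendsto (fun t : ℝ => t⁻¹ * ∫ ω, ω.totalReward t ∂(M.pathLaw π s) - t⁻¹ *
      ∫ ω, Path.cumul (fun y => M.mean (increment ρ v) y.1) t ω ∂(M.pathLaw π s))
      atTop (𝓝 ρ) := by
  obtain ⟨K, hK⟩ := hM.exists_abs_integral_totalReward_le π s ρ v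
  rw [tendsto_iff_norm_sub_tendsto_zero]
  refine squeeze_zero' (Eventually.of_forall fun _ => norm_nonneg _) ?_
    (tendsto_mul_sqrt_add_one_div K)
  filter_upwards [eventually_gt_atTop 0] with t ht
  have e : ∀ a b : ℝ, t⁻¹ * a - t⁻¹ * b - ρ = t⁻¹ * (a - ρ * t - b) := fun a b => by
    field_simp; ring
  rw [e, norm_mul, Real.norm_of_nonneg (inv_nonneg.2 ht.le)]
  exact mul_le_mul_of_nonneg_left (hK t ht.le) (inv_nonneg.2 ht.le)

/-- The rate in the average-reward optimality equation is the optimal reward rate. -/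
theorem Regular.optimalRate_eq [Nonempty A] (hM : M.Regular) {ρ : ℝ} {v : S → ℝ}
    (hv : bellman M.transProb (fun s a => M.meanReward s a - M.meanTime s a * ρ) v = v) (s : S) :
    M.optimalRate s = ρ := by
  set L := lookahead M.transProb (fun s a => M.meanReward s a - M.meanTime s a * ρ) v with hL
  have hmean : ∀ x : S × A, M.mean (increment ρ v) x = L x - v x.1 := fun x =>
    hM.mean_increment ρ v x.1 x.2
  have hle : ∀ x : S × A, M.mean (increment ρ v) x ≤ 0 := fun x => by
    have := le_maxVal L x.1 x.2
    rw [hL, ← bellman, hv] at this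
    rw [hmean]
    linarith
  have hupper : ∀ π, M.rewardRate π s ≤ ρ := by
    intro π
    have hT := hM.tendsto_rate_sub π s ρ v
    have hcum0 : ∀ t, ∫ ω, Path.cumul (fun y => M.mean (increment ρ v) y.1) t ω
        ∂(M.pathLaw π s) ≤ 0 := fun t =>
      integral_nonpos fun ω => Finset.sum_nonpos fun n _ => hle _
    obtain ⟨δ, hδ, hδm⟩ := hM.exists_mean_min_time
    obtain ⟨C, hC⟩ : ∃ C, ∀ x, -M.mean (increment ρ v) x ≤ C := by
      obtain ⟨C, hC⟩ := (Set.finite_range fun x => -M.mean (increment ρ v) x).bddAbove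
      exact ⟨C, fun x => hC ⟨x, rfl⟩⟩
    -- Serves only to bound the reward averages below: comparing real-valued lower limits requires
    -- boundedness.
    have hlow : ∀ t : ℝ, 1 ≤ t → -(|C| * 2 / δ) ≤ t⁻¹ *
        ∫ ω, Path.cumul (fun y => M.mean (increment ρ v) y.1) t ω ∂(M.pathLaw π s) := by
      intro t ht
      have ht0 : 0 < t := by linarith
      have h1 := integral_cumul_le (g := fun y => -M.mean (increment ρ v) y.1) π s hM hδ hδm
        ht0.le ((Measurable.of_discrete (f := fun x => -M.mean (increment ρ v) x)).comp
          measurable_fst)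
        (fun x => integrable_const (-M.mean (increment ρ v) x)) (abs_nonneg C)
        (fun x => by simpa [mean] using (hC x).trans (le_abs_self C))
      have h2 : ∀ ω : Path S A, Path.cumul (fun y => -M.mean (increment ρ v) y.1) t ω =
          -Path.cumul (fun y => M.mean (increment ρ v) y.1) t ω := fun ω =>
        Finset.sum_neg_distrib _
      simp only [h2, integral_neg] at h1
      have h3 : |C| * ((t + 1) / δ) ≤ t * (|C| * 2 / δ) := by
        rw [mul_div_assoc', mul_div_assoc']
        refine div_le_div_of_nonneg_right ?_ hδ.le
        nlinarith [abs_nonneg C]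
      rw [inv_mul_eq_div, le_div_iff₀ ht0]
      linarith
    have hbdd : IsBoundedUnder (· ≥ ·) atTop
        (fun t : ℝ => t⁻¹ * ∫ ω, ω.totalReward t ∂(M.pathLaw π s)) := by
      refine ⟨ρ - 1 - |C| * 2 / δ, eventually_map.2 ?_⟩
      filter_upwards [hT.eventually (lt_mem_nhds (show ρ - 1 < ρ by linarith)),
        eventually_ge_atTop 1] with t h1 h2
      have := hlow t h2
      simp only [ge_iff_le]
      linarith
    have h := liminf_le_liminf (f := atTop)
      (u := fun t : ℝ => t⁻¹ * ∫ ω, ω.totalReward t ∂(M.pathLaw π s)) (v := fun t : ℝ =>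
        t⁻¹ * ∫ ω, ω.totalReward t ∂(M.pathLaw π s) - t⁻¹ *
        ∫ ω, Path.cumul (fun y => M.mean (increment ρ v) y.1) t ω ∂(M.pathLaw π s)) (by
        filter_upwards [eventually_gt_atTop 0] with t ht
        have := mul_nonpos_of_nonneg_of_nonpos (inv_nonneg.2 ht.le) (hcum0 t)
        linarith) hbdd hT.isCoboundedUnder_ge
    rwa [hT.liminf_eq] at h
  choose σ hσ using fun s => exists_maxVal_eq L s
  -- A maximizing selector makes every mean increment along the trajectory zero, so `ρ` is attained
  -- by a stationary policy.
  have hopt : M.rewardRate (Policy.ofSelector σ) s = ρ := by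
    have hT := hM.tendsto_rate_sub (Policy.ofSelector σ) s ρ v
    have h0 : ∀ t, ∫ ω, Path.cumul (fun y => M.mean (increment ρ v) y.1) t ω
        ∂(M.pathLaw (Policy.ofSelector σ) s) = 0 := by
      intro t
      refine integral_eq_zero_of_ae ?_
      filter_upwards [M.ae_action_eq σ s] with ω hω
      refine Finset.sum_eq_zero fun n _ => ?_
      have h1 := hσ (ω.state n)
      rw [hL, ← bellman, hv] at h1
      simp only [Path.transition, hω n, hmean, hL, ← h1, sub_self]
    simp only [h0, mul_zero, sub_zero] at hT
    exact hT.liminf_eq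
  have : Nonempty (Policy S A) := ⟨Policy.ofSelector σ⟩
  refine le_antisymm (ciSup_le hupper) ?_
  rw [← hopt]
  exact le_ciSup (f := fun π => M.rewardRate π s) ⟨ρ, by rintro _ ⟨π, rfl⟩; exact hupper π⟩ _

end Verification

end SMDP

/-! ### Level translations and the scaling limit of `f` -/

section RateEstimator

variable {ι : Type u} [Fintype ι] {f fInf : (ι → ℝ) → ℝ}

/-- The translation which brings a continuous SISTr function to a given level depends continuously
on the point. -/
lemma SISTr.exists_continuous_level (hf : SISTr f) (hc : Continuous f) (ρ : ℝ) :
    ∃ c : (ι → ℝ) → ℝ, Continuous c ∧ ∀ x, f (fun i => x i + c x) = ρ := by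
  choose c hcρ using fun x => (hf x).2 ρ
  simp only at hcρ
  refine ⟨c, continuous_iff_continuousAt.2 fun x => ?_, hcρ⟩
  have hcont : ∀ b : ℝ, Continuous fun y : ι → ℝ => f fun i => y i + b := fun b => by fun_prop
  refine tendsto_order.2 ⟨fun b hb => ?_, fun b hb => ?_⟩
  · have h1 : f (fun i => x i + b) < ρ := hcρ x ▸ (hf x).1 hb
    filter_upwards [(hcont b).continuousAt.eventually (gt_mem_nhds h1)] with y hy
    exact (hf y).1.lt_iff_lt.1 (by simpa only [hcρ y] using hy)
  · have h1 : ρ < f (fun i => x i + b) := by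
      have := (hf x).1 hb
      simp only [hcρ x] at this
      exact this
    filter_upwards [(hcont b).continuousAt.eventually (lt_mem_nhds h1)] with y hy
    exact (hf y).1.lt_iff_lt.1 (by simpa only [hcρ y] using hy)

lemma RateEstimator.continuous (hf : RateEstimator f fInf) : Continuous f := by
  obtain ⟨K, hK⟩ := hf.lipschitz
  exact hK.continuous

/-- At the origin the scaling quotient is the fixed number `f 0` divided by `c`. -/
lemma RateEstimator.fInf_zero (hf : RateEstimator f fInf) : fInf 0 = 0 := by
  refine tendsto_nhds_unique (hf.scaling 0) ?_
  simp only [smul_zero]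
  exact tendsto_const_nhds.div_atTop tendsto_id

lemma RateEstimator.eq_zero_of_const (hf : RateEstimator f fInf) {c : ℝ}
    (hc : fInf (fun _ => c) = 0) : c = 0 := by
  refine hf.sistr_zero.1.injective ?_
  simp only [Pi.zero_apply, zero_add]
  rw [hc]
  exact hf.fInf_zero.symm

/-- The scaling limit along moving directions. -/
lemma RateEstimator.tendsto_div (hf : RateEstimator f fInf) {x : ℕ → ι → ℝ} {b : ℕ → ℝ}
    {y : ι → ℝ} (hb : Tendsto b atTop atTop) (hx : Tendsto (fun k => (b k)⁻¹ • x k) atTop (𝓝 y)) :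
    Tendsto (fun k => f (x k) / b k) atTop (𝓝 (fInf y)) := by
  obtain ⟨K, hK⟩ := hf.lipschitz
  have h1 : Tendsto (fun k => f (b k • y) / b k) atTop (𝓝 (fInf y)) := (hf.scaling y).comp hb
  have h2 : Tendsto (fun k => f (x k) / b k - f (b k • y) / b k) atTop (𝓝 0) := by
    have h3 : Tendsto (fun k => (K : ℝ) * ‖(b k)⁻¹ • x k - y‖) atTop (𝓝 0) := by
      simpa using (tendsto_iff_norm_sub_tendsto_zero.1 hx).const_mul (K : ℝ)
    refine squeeze_zero_norm' ?_ h3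
    filter_upwards [hb.eventually_gt_atTop 0] with k hk
    have h4 : x k - b k • y = b k • ((b k)⁻¹ • x k - y) := by
      rw [smul_sub, smul_inv_smul₀ hk.ne']
    have h5 := hK.dist_le_mul (x k) (b k • y)
    rw [dist_eq_norm, dist_eq_norm, h4, norm_smul, Real.norm_of_nonneg hk.le] at h5
    rw [← sub_div, norm_div, Real.norm_of_nonneg hk.le, div_le_iff₀ hk]
    linarith
  simpa using h2.add h1

end RateEstimator

namespace SMDP

/-! ### Solutions in state-action form: connectedness, rate zero, boundedness -/

section Solutions

variable {S A : Type u} [Fintype S] [Fintype A] [Nonempty A]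
variable {p : S → A → S → ℝ} {r t : S → A → ℝ}

/-- State-action solutions are the image under `lookahead` of the fixed points for state values,
`maxVal` giving the way back. -/
lemma IsTransition.isPreconnected_qSolutions (hp : IsTransition p) :
    IsPreconnected {q | lookahead p r (maxVal q) = q} := by
  have e : {q | lookahead p r (maxVal q) = q} = lookahead p r '' {v | bellman p r v = v} := by
    ext q
    constructor
    · intro hq
      exact ⟨maxVal q, congrArg maxVal hq, hq⟩
    · rintro ⟨v, hv, rfl⟩
      exact congrArg (lookahead p r) hv
  rw [e]
  exact hp.isPreconnected_fixedPoints.image _ continuous_lookahead.continuousOn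

lemma IsTransition.add_const_mem_qSolutions (hp : IsTransition p) {q : S × A → ℝ}
    (hq : lookahead p r (maxVal q) = q) (c : ℝ) :
    lookahead p r (maxVal fun x => q x + c) = fun x => q x + c := by
  have e : (maxVal fun x => q x + c) = fun s => maxVal q s + c :=
    funext fun s => maxVal_add_const q c s
  rw [e, hp.lookahead_add_const, hq]

/-- If `z = p (max z)` then `z` is constant. -/
lemma HarmonicConst.exists_const [Nonempty S] (hp : IsTransition p) (hH : HarmonicConst p)
    {q : S × A → ℝ} (hq : lookahead p 0 (maxVal q) = q) : ∃ c : ℝ, q = fun _ => c := by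
  obtain ⟨s₀⟩ := ‹Nonempty S›
  have h := hH (maxVal q) (congrArg maxVal hq)
  refine ⟨maxVal q s₀, ?_⟩
  funext x
  conv_lhs => rw [← hq]
  simp only [lookahead, fun s => h s s₀, ← Finset.sum_mul, hp.sum_eq_one]
  simp

/-- With zero rewards, the rate in the optimality equation vanishes. -/
lemma IsTransition.rate_eq_zero [Nonempty S] (hp : IsTransition p) (ht : ∀ s a, 0 < t s a) {ρ : ℝ}
    {v : S → ℝ} (hv : bellman p (fun s a => -(t s a * ρ)) v = v) : ρ = 0 := by
  obtain ⟨sM, hsM⟩ := Finite.exists_max v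
  obtain ⟨sm, hsm⟩ := Finite.exists_min v
  apply le_antisymm
  -- At a maximizer of `v` averaging cannot increase the value, so `t ρ ≤ 0`; at a minimizer the
  -- reverse inequality results.
  · obtain ⟨a, ha⟩ := exists_maxVal_eq (lookahead p (fun s a => -(t s a * ρ)) v) sM
    rw [← bellman, hv, lookahead] at ha
    have h1 : ∑ s', p sM a s' * v s' ≤ v sM := by
      calc ∑ s', p sM a s' * v s' ≤ ∑ s', p sM a s' * v sM :=
            Finset.sum_le_sum fun s' _ => mul_le_mul_of_nonneg_left (hsM s') (hp.nonneg _ _ _)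
        _ = v sM := by rw [← Finset.sum_mul, hp.sum_eq_one, one_mul]
    simp only at ha
    exact nonpos_of_mul_nonpos_right (by linarith) (ht sM a)
  · obtain ⟨a⟩ := ‹Nonempty A›
    have : Nonempty A := ⟨a⟩
    have ha := le_maxVal (lookahead p (fun s a => -(t s a * ρ)) v) sm a
    rw [← bellman, hv, lookahead] at ha
    have h1 : v sm ≤ ∑ s', p sm a s' * v s' := by
      calc v sm = ∑ s', p sm a s' * v sm := by rw [← Finset.sum_mul, hp.sum_eq_one, one_mul]
        _ ≤ ∑ s', p sm a s' * v s' :=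
            Finset.sum_le_sum fun s' _ => mul_le_mul_of_nonneg_left (hsm s') (hp.nonneg _ _ _)
    simp only at ha
    exact nonneg_of_mul_nonneg_right (by linarith) (ht sm a)

/-- Blow-up: after division by the norm, rewards and the level `ρ` both become negligible. The limit
is a constant of norm one at which `fInf` vanishes, which SISTr at the origin forbids. -/
lemma isBounded_level_qSolutions [Nonempty S] (hp : IsTransition p) (hH : HarmonicConst p)
    {f fInf : (S × A → ℝ) → ℝ} (hf : RateEstimator f fInf) (ρ : ℝ) :
    Bornology.IsBounded {q | lookahead p r (maxVal q) = q ∧ f q = ρ} := by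
  by_contra hnb
  have hex : ∀ k : ℕ, ∃ q, (lookahead p r (maxVal q) = q ∧ f q = ρ) ∧ (k : ℝ) + 1 < ‖q‖ := by
    intro k
    by_contra! h
    exact hnb (isBounded_iff_forall_norm_le.2 ⟨(k : ℝ) + 1, fun q hq => h q hq⟩)
  choose q hq hqn using hex
  have hpos : ∀ k, 0 < ‖q k‖ := fun k => by
    have : (0 : ℝ) ≤ k := Nat.cast_nonneg k
    linarith [hqn k]
  have hb : Tendsto (fun k => ‖q k‖) atTop atTop :=
    tendsto_atTop_mono (fun k => by linarith [hqn k]) tendsto_natCast_atTop_atTop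
  have hsph : ∀ k, ‖q k‖⁻¹ • q k ∈ Metric.sphere (0 : S × A → ℝ) 1 := fun k => by
    rw [mem_sphere_zero_iff_norm, norm_smul, norm_inv, norm_norm, inv_mul_cancel₀ (hpos k).ne']
  obtain ⟨y, hy, φ, hφ, hlim⟩ := (isCompact_sphere (0 : S × A → ℝ) 1).tendsto_subseq hsph
  have hb' : Tendsto (fun k => ‖q (φ k)‖) atTop atTop := hb.comp hφ.tendsto_atTop
  have hyfix : lookahead p 0 (maxVal y) = y := by
    have h1 : Tendsto (fun k => lookahead p 0 (maxVal (‖q (φ k)‖⁻¹ • q (φ k)))) atTop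
        (𝓝 (lookahead p 0 (maxVal y))) :=
      ((continuous_lookahead.comp continuous_maxVal).tendsto y).comp hlim
    have h2 : Tendsto (fun k => ‖q (φ k)‖⁻¹ • q (φ k) -
        ‖q (φ k)‖⁻¹ • fun x : S × A => r x.1 x.2) atTop (𝓝 y) := by
      have h3 : Tendsto (fun k => ‖q (φ k)‖⁻¹) atTop (𝓝 0) := tendsto_inv_atTop_zero.comp hb'
      simpa using hlim.sub (h3.smul_const fun x : S × A => r x.1 x.2)
    refine tendsto_nhds_unique h1 (h2.congr fun k => ?_)
    funext x
    have h4 := congrFun (hq (φ k)).1 x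
    have h5 : ∀ s, maxVal (‖q (φ k)‖⁻¹ • q (φ k)) s = ‖q (φ k)‖⁻¹ * maxVal (q (φ k)) s := fun s =>
      maxVal_const_mul (q (φ k)) (inv_nonneg.2 (norm_nonneg _)) s
    simp only [lookahead, h5, Pi.sub_apply, Pi.smul_apply, smul_eq_mul, Pi.zero_apply, zero_add]
      at h4 ⊢
    rw [← h4, mul_add, add_sub_cancel_left, Finset.mul_sum]
    exact Finset.sum_congr rfl fun _ _ => by ring
  obtain ⟨c, rfl⟩ := hH.exists_const hp hyfix
  have h6 := hf.tendsto_div hb' hlim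
  simp only [fun k => (hq k).2] at h6
  have h7 := tendsto_nhds_unique h6 (tendsto_const_nhds.div_atTop hb')
  have h8 := hf.eq_zero_of_const h7
  rw [mem_sphere_zero_iff_norm, h8] at hy
  exact zero_ne_one ((norm_zero (E := S × A → ℝ)).symm.trans hy)

end Solutions

/-! ### The constrained solution set with a fixed rate, and the conclusion -/

section Main

variable {S A : Type u} [Fintype S] [Fintype A] [Nonempty A] [MeasurableSpace S]
  [MeasurableSpace A] [MeasurableSingletonClass S] [MeasurableSingletonClass A] {M : SMDP S A}

lemma mem_solutionSet_iff {q : S × A → ℝ} : q ∈ M.solutionSet ↔ ∃ ρ : ℝ,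
    lookahead M.transProb (fun s a => M.meanReward s a - M.meanTime s a * ρ) (maxVal q) = q := by
  refine exists_congr fun ρ => ⟨fun h => funext fun x => (h x.1 x.2).symm, fun h s a => ?_⟩
  exact (congrFun h (s, a)).symm

/-- Verification removes the existential quantifier over rates: any rate that admits a solution is
the optimal one. -/
lemma Regular.constrainedSolutionSet_eq [Nonempty S] (hM : M.Regular) {ρ : ℝ}
    (hρ : ∀ s, M.optimalRate s = ρ) (f : (S × A → ℝ) → ℝ) :
    M.constrainedSolutionSet f = {q | lookahead M.transProb
      (fun s a => M.meanReward s a - M.meanTime s a * ρ) (maxVal q) = q ∧ f q = ρ} := by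
  obtain ⟨s₀⟩ := ‹Nonempty S›
  ext q
  constructor
  · rintro ⟨h, hf⟩
    obtain ⟨ρ', h⟩ := mem_solutionSet_iff.1 h
    obtain rfl : ρ' = ρ := by
      rw [← hρ s₀, hM.optimalRate_eq (congrArg maxVal h) s₀]
    exact ⟨h, (hf s₀).trans (hρ s₀)⟩
  · rintro ⟨h, hf⟩
    exact ⟨mem_solutionSet_iff.2 ⟨ρ, h⟩, fun s => hf.trans (hρ s).symm⟩

end Main

end SMDP

end

theorem mainTheorem7 {S A : Type u} [Fintype S] [Fintype A] [Nonempty A]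
    [MeasurableSpace S] [MeasurableSpace A] [MeasurableSingletonClass S] [MeasurableSingletonClass A]
    (M : SMDP S A) (hM : M.Regular) (hW : M.WeaklyCommunicating)
    (f fInf : (S × A → ℝ) → ℝ) (hf : RateEstimator f fInf) :
    ((M.constrainedSolutionSet f).Nonempty ∧ IsCompact (M.constrainedSolutionSet f) ∧
      IsConnected (M.constrainedSolutionSet f)) ∧
    M.zeroRewardSolutionSet fInf = {0} := by
  have hS := hW.nonempty
  have hp := M.isTransition_transProb
  have hH := hW.harmonicConst
  obtain ⟨ρ, v, hv⟩ := hp.exists_bellman_eq (r := M.meanReward) hH hM.meanTime_pos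
  rw [hM.constrainedSolutionSet_eq (hM.optimalRate_eq hv) f]
  set r : S → A → ℝ := fun s a => M.meanReward s a - M.meanTime s a * ρ
  obtain ⟨c, hc, hcρ⟩ := hf.sistr.exists_continuous_level hf.continuous ρ
  -- The map `q ↦ q + c q` retracts all solutions onto those at level `ρ`: strict monotonicity gives
  -- `c q = 0` when `f q = ρ` already.
  have himage : {q | SMDP.lookahead M.transProb r (SMDP.maxVal q) = q ∧ f q = ρ} =
      (fun q x => q x + c q) '' {q | SMDP.lookahead M.transProb r (SMDP.maxVal q) = q} := by
    ext q
    constructor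
    · rintro ⟨hq, hfq⟩
      refine ⟨q, hq, ?_⟩
      have h0 : c q = 0 := by
        refine (hf.sistr q).1.injective ?_
        simp only [hcρ, add_zero, hfq]
      simp [h0]
    · rintro ⟨q, hq, rfl⟩
      exact ⟨hp.add_const_mem_qSolutions hq _, hcρ q⟩
  have hconn : IsConnected {q | SMDP.lookahead M.transProb r (SMDP.maxVal q) = q ∧ f q = ρ} := by
    rw [himage]
    refine ⟨Set.Nonempty.image _ ⟨SMDP.lookahead M.transProb r v,
      congrArg (SMDP.lookahead M.transProb r) hv⟩, ?_⟩
    have hcont : Continuous fun (q : S × A → ℝ) (x : S × A) => q x + c q := by fun_prop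
    exact hp.isPreconnected_qSolutions.image _ hcont.continuousOn
  have hclosed : IsClosed {q | SMDP.lookahead M.transProb r (SMDP.maxVal q) = q ∧ f q = ρ} :=
    (isClosed_eq (SMDP.continuous_lookahead.comp SMDP.continuous_maxVal) continuous_id).inter
      (isClosed_eq hf.continuous continuous_const)
  refine ⟨⟨hconn.nonempty, Metric.isCompact_of_isClosed_isBounded hclosed
    (SMDP.isBounded_level_qSolutions hp hH hf ρ), hconn⟩, ?_⟩
  ext q
  rw [Set.mem_singleton_iff]
  constructor
  · intro hq
    have hq1 : SMDP.lookahead M.transProb (fun s a => -(M.meanTime s a * fInf q))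
        (SMDP.maxVal q) = q := funext fun x => (hq x.1 x.2).symm
    have h0 : fInf q = 0 := hp.rate_eq_zero hM.meanTime_pos (congrArg SMDP.maxVal hq1)
    simp only [h0, mul_zero, neg_zero] at hq1
    obtain ⟨b, rfl⟩ := hH.exists_const hp hq1
    have hb := hf.eq_zero_of_const h0
    subst hb
    rfl
  · rintro rfl s a
    have h0 : ∀ s, SMDP.maxVal (0 : S × A → ℝ) s = 0 := fun s => by
      obtain ⟨a, ha⟩ := SMDP.exists_maxVal_eq (0 : S × A → ℝ) s
      exact ha
    simp [hf.fInf_zero, h0]
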